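/- Let $M$ be a smooth orientable $n$-manifold, $n\ge 2$, with a projective structure $\boldsymbol p$: an equivalence class of torsion-free affine connections, where $\widehat\nabla\sim\nabla$ if $\widehat\nabla_a v^b=\nabla_a v^b+\Upsilon_a v^b+\delta_a^b\,\Upsilon_c v^c$ for some one-form $\Upsilon$. Write $\mathcal E(w)=\big((\wedge^nT^*M)^2\big)^{-w/2(n+1)}$ and $\mathcal B(w)=\mathcal B\otimes\mathcal E(w)$. For $\nabla\in\boldsymbol p$ with $[\nabla_a,\nabla_b]\omega_c=-R_{ab}{}^d{}_c\,\omega_d$, define the Weyl and Schouten tensors $W,Q$ by $R_{ab}{}^d{}_c=W_{ab}{}^d{}_c+2\delta^d_{[a}Q_{b]c}-2Q_{[ab]}\delta^d_c$ with $W$ trace-free, and the Cotton tensor by $C_{abc}=\nabla_aQ_{bc}-\nabla_bQ_{ac}$. Put $W_{abc}{}^d:=W_{ab}{}^d{}_c$. A section of the tractor bundle $\mathcal T_{(AB)}$ is, for each $\nabla\in\boldsymbol p$, a triple $(\tau,v_a,w_{ab})$ of sections of $\mathcal E(2)$, $T^*M(2)$, $\odot^2T^*M(2)$, which transforms under $\nabla\mapsto\widehat\nabla$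 by $\tau\mapsto\tau$, $v_a\mapsto v_a+\Upsilon_a\tau$, $w_{ab}\mapsto w_{ab}+\Upsilon_av_b+\Upsilon_bv_a+\Upsilon_a\Upsilon_b\tau$. Let $$(d^\nabla s)_c=\big(\nabla_c\tau-2v_c,\ \nabla_cv_a+Q_{ca}\tau-w_{ca},\ \nabla_cw_{ab}+2Q_{c(a}v_{b)}\big)$$ be the tractor connection (a well-defined map from sections of $\mathcal T_{(AB)}$ to $\mathcal T_{(AB)}$-valued one-forms). Let $\partial^*(\tau_c,v_{ca},w_{cab})=(0,\tau_a,2v_{(ab)})$ be the Kostant codifferential, and let $q:(T^*M\otimes\odot^2T^*M)(2)\to T^*M\otimes\mathcal T_{(AB)}$, $q(\alpha)=(0,0,\alpha_{cab})$, be insertion into the bottom slot. Then: 1. For each $\sigma\in\mathcal E(2)$ there is exactly one section $L_0\sigma$ of $\mathcal T_{(AB)}$ with top slot $\sigma$ and $\partial^*d^\nabla L_0\sigma=0$. It is $L_0\sigma=\big(\sigma,\tfrac12\nabla_a\sigma,(\tfrac12\nabla_a\nabla_b+Q_{ab})\sigma\big)$ for every $\nabla\in\boldsymbol p$. 2. The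 formula $$\widetilde{\mathcal D}\sigma=\tfrac12\nabla_c\nabla_a\nabla_b\sigma+Q_{c(a}\nabla_{b)}\sigma+\nabla_c(Q_{ab}\sigma)$$ defines an operator $\widetilde{\mathcal D}:\mathcal E(2)\to(T^*M\otimes\odot^2T^*M)(2)$ that does not depend on the choice of $\nabla\in\boldsymbol p$, and $$d^\nabla\circ L_0=q\circ\widetilde{\mathcal D}.$$ 3. The operator $\sigma\mapsto\big(W_{a(bc)}{}^d\nabla_d-2C_{a(bc)}\big)\sigma$ from $\mathcal E(2)$ to $(T^*M\otimes\odot^2T^*M)(2)$ is projectively invariant, i.e. does not depend on $\nabla\in\boldsymbol p$. Its totally symmetric part vanishes, and up to a constant factor it is the mixed-symmetry part of $\widetilde{\mathcal D}$: $$(\widetilde{\mathcal D}\sigma)_{cab}-(\widetilde{\mathcal D}\sigma)_{(cab)}=-\tfrac13\big(W_{c(ab)}{}^d\nabla_d-2C_{c(ab)}\big)\sigma .$$ -/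

import Mathlib

open scoped Manifold ContDiff

noncomputable section

namespace ProjectiveGeometry

/-- A raw covariant `k`-index field: at each point a real function of `k` tangent vectors.
The actual tensor fields are singled out by `IsTensorField`. -/
abbrev RawField (n : ℕ) (M : Type*) [TopologicalSpace M]
    [ChartedSpace (EuclideanSpace ℝ (Fin n)) M] (k : ℕ) : Type _ :=
  (x : M) → (Fin k → TangentSpace (𝓡 n) x) → ℝ

section

variable {n : ℕ} {M : Type*} [TopologicalSpace M]
  [ChartedSpace (EuclideanSpace ℝ (Fin n)) M] [IsManifold (𝓡 n) ∞ M]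

/-- A vector field is smooth at `x`. -/
def SmoothVecAt (V : (y : M) → TangentSpace (𝓡 n) y) (x : M) : Prop :=
  ContMDiffAt (𝓡 n) (𝓡 n).tangent ∞
    (fun y => (⟨y, V y⟩ : TangentBundle (𝓡 n) M)) x

/-- `T` is a smooth section of `⊗ᵏ T*M`: pointwise multilinear, and smooth when evaluated on
smooth vector fields. -/
structure IsTensorField {k : ℕ} (T : RawField n M k) : Prop where
  multilinear : ∀ x : M,
    ∃ f : MultilinearMap ℝ (fun _ : Fin k => TangentSpace (𝓡 n) x) ℝ, ∀ v, T x v = f v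
  smooth : ∀ (V : Fin k → (y : M) → TangentSpace (𝓡 n) y) (x : M),
    (∀ i, SmoothVecAt (V i) x) →
      ContMDiffAt (𝓡 n) 𝓘(ℝ, ℝ) ∞ (fun y => T y (fun i => V i y)) x

variable (n M) in
/-- A smooth torsion-free affine connection on `M`. -/
structure AffineConn where
  cov : CovariantDerivative (𝓡 n) (EuclideanSpace ℝ (Fin n))
    (TangentSpace (𝓡 n) : M → Type _)
  smooth : cov.ContMDiffCovariantDerivative ∞
  torsion_free : cov.torsion = 0

/-- Some local smooth vector field with value `v` at `x`. -/
def ext {x : M} (v : TangentSpace (𝓡 n) x) : (y : M) → TangentSpace (𝓡 n) y :=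
  FiberBundle.extend (EuclideanSpace ℝ (Fin n)) v

/-- The tangent vectors at `x` corresponding to the standard basis of the model space. -/
def stdBasis (x : M) (i : Fin n) : TangentSpace (𝓡 n) x :=
  (EuclideanSpace.single i (1 : ℝ) : EuclideanSpace ℝ (Fin n))

/-- The coordinates of a tangent vector in the basis `stdBasis`. -/
def stdCoord {x : M} (v : TangentSpace (𝓡 n) x) (i : Fin n) : ℝ :=
  (show EuclideanSpace ℝ (Fin n) from v) i

namespace AffineConn

variable (D : AffineConn n M)

/-- Covariant derivative of covariant tensor fields, derivative index first:
`(∇T)(u, v₁, …, vₖ) = u(T(V₁, …, Vₖ)) - ∑ᵢ T(v₁, …, ∇_u Vᵢ, …, vₖ)`, for any local vector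
fields `Vᵢ` with `Vᵢ x = vᵢ`. -/
def covD {k : ℕ} (T : RawField n M k) : RawField n M (k + 1) := fun x v =>
  mvfderiv (𝓡 n) (fun y => T y (fun i => ext (Fin.tail v i) y)) x (v 0)
    - ∑ i : Fin k, T x (Function.update (Fin.tail v) i (D.cov (ext (Fin.tail v i)) x (v 0)))

/-- The curvature `R(u,v)w = ∇_u ∇_v w - ∇_v ∇_u w - ∇_{[u,v]} w`, i.e. `u^a v^b w^c R_{ab}{}^d{}_c`
where `[∇_a, ∇_b] ω_c = - R_{ab}{}^d{}_c ω_d`. -/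
def curv (x : M) (u v w : TangentSpace (𝓡 n) x) : TangentSpace (𝓡 n) x :=
  D.cov (fun y => D.cov (ext w) y (ext v y)) x u
    - D.cov (fun y => D.cov (ext w) y (ext u y)) x v
    - D.cov (ext w) x (VectorField.mlieBracket (𝓡 n) (ext u) (ext v) x)

/-- The Ricci tensor `Ric_{bc} = R_{ab}{}^a{}_c`. -/
def ric : RawField n M 2 := fun x v =>
  ∑ i : Fin n, stdCoord (D.curv x (stdBasis x i) (v 0) (v 1)) i

/-- The projective Schouten tensor: the tensor `Q` for which the tensor `W` defined by
`R_{ab}{}^d{}_c = W_{ab}{}^d{}_c + 2 δ_{[a}^d Q_{b]c} - 2 Q_{[ab]} δ^d_c` is trace-free.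
Contracting `a` with `d` gives `Ric_{bc} = n Q_{bc} - Q_{cb}`, which is solved here for `Q`. -/
def schouten : RawField n M 2 := fun x v =>
  ((n : ℝ) * D.ric x ![v 0, v 1] + D.ric x ![v 1, v 0]) / ((n : ℝ) ^ 2 - 1)

/-- The projective Weyl tensor `W(u,v)w = u^a v^b w^c W_{ab}{}^d{}_c`. -/
def weyl (x : M) (u v w : TangentSpace (𝓡 n) x) : TangentSpace (𝓡 n) x :=
  D.curv x u v w
    - (D.schouten x ![v, w] • u - D.schouten x ![u, w] • v)
    + (D.schouten x ![u, v] - D.schouten x ![v, u]) • w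

/-- The projective Cotton tensor `C_{abc} = ∇_a Q_{bc} - ∇_b Q_{ac}`. -/
def cotton : RawField n M 3 := fun x v =>
  D.covD D.schouten x ![v 0, v 1, v 2] - D.covD D.schouten x ![v 1, v 0, v 2]

end AffineConn

/-- `∇̂_a v^b = ∇_a v^b + Υ_a v^b + δ_a^b Υ_c v^c`. -/
def ProjChange (D D' : AffineConn n M) (Y : RawField n M 1) : Prop :=
  ∀ (x : M) (V : (y : M) → TangentSpace (𝓡 n) y),
    MDifferentiableAt (𝓡 n) (𝓡 n).tangent
      (fun y => (⟨y, V y⟩ : TangentBundle (𝓡 n) M)) x →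
    ∀ u : TangentSpace (𝓡 n) x,
      D'.cov V x u = D.cov V x u + Y x ![u] • V x + Y x ![V x] • u

variable (n M) in
/-- A projective structure: an equivalence class of torsion-free affine connections, where
two connections are equivalent if they differ by some smooth one-form as in `ProjChange`. -/
structure ProjectiveStructure where
  conns : Set (AffineConn n M)
  nonempty : conns.Nonempty
  mem_iff : ∀ D ∈ conns, ∀ D' : AffineConn n M,
    D' ∈ conns ↔ ∃ Y : RawField n M 1, IsTensorField Y ∧ ProjChange D D' Y

variable (n M) in
/-- A smooth nowhere vanishing `n`-form on `M`. -/
structure VolumeForm where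
  form : (x : M) → TangentSpace (𝓡 n) x [⋀^Fin n]→ₗ[ℝ] ℝ
  ne_zero : ∀ x, form x ≠ 0
  smooth : IsTensorField (n := n) (M := M) (fun x v => form x v)

variable (n M) in
/-- A section of `(⊗ᵏ T*M)(w) = (⊗ᵏ T*M) ⊗ ((⋀ⁿ T*M)²)^{-w/2(n+1)}` on an orientable manifold.
A volume form `ω` trivialises the density bundle by `|ω|^{-w/(n+1)} = (ω²)^{-w/2(n+1)}`, and
`comp ω` is the tensor field `T` with section `T ⊗ |ω|^{-w/(n+1)}`. Thus `comp` scales pointwise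
by `|c|^{w/(n+1)}` when `ω` is replaced by `c ω`. -/
@[ext] structure TensorDensity (k : ℕ) (w : ℝ) where
  comp : VolumeForm n M → RawField n M k
  isTensor : ∀ vol, IsTensorField (comp vol)
  scale : ∀ (vol vol' : VolumeForm n M) (x : M) (c : ℝ), vol'.form x = c • vol.form x →
    ∀ v, comp vol' x v = |c| ^ (w / ((n : ℝ) + 1)) * comp vol x v

variable (n M) in
/-- A section of `(T*M ⊗ ⊙² T*M)(w)`, index order `α_{cab}`. -/
@[ext] structure OneTwoDensity (w : ℝ) extends TensorDensity n M 3 w where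
  symm : ∀ (vol : VolumeForm n M) (x : M) (c a b : TangentSpace (𝓡 n) x),
    comp vol x ![c, a, b] = comp vol x ![c, b, a]

/-- Total symmetrisation `T_{(abc)}`. -/
def symm3 (T : RawField n M 3) : RawField n M 3 := fun x v =>
  (1 / 6) * ∑ π : Equiv.Perm (Fin 3), T x (fun i => v (π i))

/-- A connection in the projective class, with a volume form trivialising the density bundles
(the volume form need not be parallel). -/
structure Gauge (p : ProjectiveStructure n M) where
  conn : AffineConn n M
  mem : conn ∈ p.conns
  vol : VolumeForm n M

namespace Gauge

variable {p : ProjectiveStructure n M} (g : Gauge p)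

/-- The one-form `θ` with `∇_a ω = θ_a ω` on the volume form `ω` of the gauge. -/
def theta : RawField n M 1 := fun x v =>
  g.conn.covD (fun y e => g.vol.form y e) x (Fin.cons (v 0) (stdBasis x))
    / g.vol.form x (stdBasis x)

/-- Covariant derivative of a weight `w` covariant tensor, computed in the trivialisation by
`|ω|^{-w/(n+1)}`, whose covariant derivative is `-(w/(n+1)) θ ⊗ |ω|^{-w/(n+1)}`. -/
def nabla (w : ℝ) {k : ℕ} (T : RawField n M k) : RawField n M (k + 1) := fun x v =>
  g.conn.covD T x v - w / ((n : ℝ) + 1) * g.theta x ![v 0] * T x (Fin.tail v)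

/-- `Q_{ab}` of the connection of the gauge. -/
abbrev Q : RawField n M 2 := g.conn.schouten

/-- Change of gauge: the connection changes by the one-form `Υ`, the volume form by the
factor `c`. -/
structure Change (g g' : Gauge p) (Y : RawField n M 1) (c : M → ℝ) : Prop where
  oneForm : IsTensorField Y
  conn : ProjChange g.conn g'.conn Y
  vol : ∀ x, g'.vol.form x = c x • g.vol.form x

end Gauge

/-- A section of the tractor bundle `𝒯_{(AB)}`, the symmetric square of the cotractor bundle:
for each connection in the class (and trivialisation of the densities) a triple
`(τ, v_a, w_{ab})` of weight two with `w_{ab}` symmetric, subject to the transformation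
`τ ↦ τ`, `v_a ↦ v_a + Υ_a τ`, `w_{ab} ↦ w_{ab} + Υ_a v_b + Υ_b v_a + Υ_a Υ_b τ`
induced by `(ω_a, σ) ↦ (ω_a + Υ_a σ, σ)` on cotractors. -/
@[ext] structure TractorSection (p : ProjectiveStructure n M) where
  top : Gauge p → RawField n M 0
  mid : Gauge p → RawField n M 1
  bot : Gauge p → RawField n M 2
  top_tensor : ∀ g, IsTensorField (top g)
  mid_tensor : ∀ g, IsTensorField (mid g)
  bot_tensor : ∀ g, IsTensorField (bot g)
  bot_symm : ∀ g (x : M) (a b : TangentSpace (𝓡 n) x), bot g x ![a, b] = bot g x ![b, a]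
  top_change : ∀ g g' Y c, Gauge.Change g g' Y c → ∀ x : M,
    top g' x ![] = |c x| ^ (2 / ((n : ℝ) + 1)) * top g x ![]
  mid_change : ∀ g g' Y c, Gauge.Change g g' Y c → ∀ (x : M) (a : TangentSpace (𝓡 n) x),
    mid g' x ![a] = |c x| ^ (2 / ((n : ℝ) + 1)) * (mid g x ![a] + Y x ![a] * top g x ![])
  bot_change : ∀ g g' Y c, Gauge.Change g g' Y c → ∀ (x : M) (a b : TangentSpace (𝓡 n) x),
    bot g' x ![a, b] = |c x| ^ (2 / ((n : ℝ) + 1)) *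
      (bot g x ![a, b] + Y x ![a] * mid g x ![b] + Y x ![b] * mid g x ![a]
        + Y x ![a] * Y x ![b] * top g x ![])

/-- A `𝒯_{(AB)}`-valued one-form: slots `(τ_c, v_{ca}, w_{cab})`, form index `c` first, with the
same transformation law in the tractor indices. -/
@[ext] structure TractorForm (p : ProjectiveStructure n M) where
  top : Gauge p → RawField n M 1
  mid : Gauge p → RawField n M 2
  bot : Gauge p → RawField n M 3
  top_tensor : ∀ g, IsTensorField (top g)
  mid_tensor : ∀ g, IsTensorField (mid g)
  bot_tensor : ∀ g, IsTensorField (bot g)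
  bot_symm : ∀ g (x : M) (c a b : TangentSpace (𝓡 n) x),
    bot g x ![c, a, b] = bot g x ![c, b, a]
  top_change : ∀ g g' Y f, Gauge.Change g g' Y f → ∀ (x : M) (c : TangentSpace (𝓡 n) x),
    top g' x ![c] = |f x| ^ (2 / ((n : ℝ) + 1)) * top g x ![c]
  mid_change : ∀ g g' Y f, Gauge.Change g g' Y f → ∀ (x : M) (c a : TangentSpace (𝓡 n) x),
    mid g' x ![c, a] = |f x| ^ (2 / ((n : ℝ) + 1)) *
      (mid g x ![c, a] + Y x ![a] * top g x ![c])
  bot_change : ∀ g g' Y f, Gauge.Change g g' Y f → ∀ (x : M) (c a b : TangentSpace (𝓡 n) x),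
    bot g' x ![c, a, b] = |f x| ^ (2 / ((n : ℝ) + 1)) *
      (bot g x ![c, a, b] + Y x ![a] * mid g x ![c, b] + Y x ![b] * mid g x ![c, a]
        + Y x ![a] * Y x ![b] * top g x ![c])

/-- `d^∇ s` for the projective tractor connection on `𝒯_{(AB)}`: in every gauge
`∇_c (τ, v_a, w_{ab}) = (∇_c τ - 2 v_c, ∇_c v_a + Q_{ca} τ - w_{ca}, ∇_c w_{ab} + 2 Q_{c(a} v_{b)})`. -/
structure IsTractorDeriv {p : ProjectiveStructure n M} (s : TractorSection p)
    (φ : TractorForm p) : Prop where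
  top : ∀ g (x : M) (c : TangentSpace (𝓡 n) x),
    φ.top g x ![c] = g.nabla 2 (s.top g) x ![c] - 2 * s.mid g x ![c]
  mid : ∀ g (x : M) (c a : TangentSpace (𝓡 n) x),
    φ.mid g x ![c, a] = g.nabla 2 (s.mid g) x ![c, a] + g.Q x ![c, a] * s.top g x ![]
      - s.bot g x ![c, a]
  bot : ∀ g (x : M) (c a b : TangentSpace (𝓡 n) x),
    φ.bot g x ![c, a, b] = g.nabla 2 (s.bot g) x ![c, a, b]
      + (g.Q x ![c, a] * s.mid g x ![b] + g.Q x ![c, b] * s.mid g x ![a])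

/-- `∂*φ = 0` for the Kostant codifferential `∂* : T*M ⊗ 𝒯_{(AB)} → 𝒯_{(AB)}`,
`∂*(Z ⊗ s) = Z · s`, where `T*M` acts on cotractors by `Z · (ω_a, σ) = (Z_a σ, 0)`. On
`𝒯_{(AB)}` this reads `Z · (τ, v_a, w_{ab}) = (0, Z_a τ, 2 Z_{(a} v_{b)})`, so that
`∂*(τ_c, v_{ca}, w_{cab}) = (0, τ_a, 2 v_{(ab)})`. -/
def IsCoclosed {p : ProjectiveStructure n M} (φ : TractorForm p) : Prop :=
  ∀ g (x : M) (a b : TangentSpace (𝓡 n) x),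
    φ.top g x ![a] = 0 ∧ φ.mid g x ![a, b] + φ.mid g x ![b, a] = 0

/-- The canonical projection `𝒯_{(AB)} → ℰ(2)` maps `s` to `σ`. -/
def ProjectsTo {p : ProjectiveStructure n M} (s : TractorSection p)
    (σ : TensorDensity n M 0 2) : Prop :=
  ∀ g : Gauge p, s.top g = σ.comp g.vol

theorem isTensorField_zero {k : ℕ} : IsTensorField (fun _ _ => 0 : RawField n M k) where
  multilinear _ := ⟨0, fun _ => rfl⟩
  smooth _ _ _ := contMDiffAt_const

/-- The insertion `q : (T*M ⊗ ⊙² T*M)(2) → T*M ⊗ 𝒯_{(AB)}` into the bottom slot. -/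
def insertBot (p : ProjectiveStructure n M) (α : OneTwoDensity n M 2) : TractorForm p where
  top _ := fun _ _ => 0
  mid _ := fun _ _ => 0
  bot g := α.comp g.vol
  top_tensor _ := isTensorField_zero
  mid_tensor _ := isTensorField_zero
  bot_tensor g := α.isTensor g.vol
  bot_symm g := α.symm g.vol
  top_change := by intros; simp
  mid_change := by intros; simp
  bot_change := by
    intro g g' Y f h x c a b
    simpa using α.scale g.vol g'.vol x (f x) (h.vol x) ![c, a, b]

/-- `½ ∇_c ∇_a ∇_b σ + Q_{c(a} ∇_{b)} σ + ∇_c (Q_{ab} σ)` in a gauge. -/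
def DtildeIn {p : ProjectiveStructure n M} (g : Gauge p) (σ : RawField n M 0) :
    RawField n M 3 := fun x v =>
  (1 / 2) * g.nabla 2 (g.nabla 2 (g.nabla 2 σ)) x ![v 0, v 1, v 2]
    + (1 / 2) * (g.Q x ![v 0, v 1] * g.nabla 2 σ x ![v 2]
        + g.Q x ![v 0, v 2] * g.nabla 2 σ x ![v 1])
    + g.nabla 2 (fun y e => g.Q y e * σ y ![]) x ![v 0, v 1, v 2]

/-- `(W_{a(bc)}{}^d ∇_d - 2 C_{a(bc)}) σ` in a gauge, where `W_{abc}{}^d = W_{ab}{}^d{}_c`. -/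
def DmixedIn {p : ProjectiveStructure n M} (g : Gauge p) (σ : RawField n M 0) :
    RawField n M 3 := fun x v =>
  (1 / 2) * (g.nabla 2 σ x ![g.conn.weyl x (v 0) (v 1) (v 2)]
      + g.nabla 2 σ x ![g.conn.weyl x (v 0) (v 2) (v 1)])
    - 2 * ((1 / 2) * (g.conn.cotton x ![v 0, v 1, v 2] + g.conn.cotton x ![v 0, v 2, v 1]))
      * σ x ![]

end

end ProjectiveGeometry

end

noncomputable section

set_option linter.unusedSectionVars false

/-! The heart of the matter is that the slots of $d^\nabla s$ transform like those of a tractor.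
Under a change of connection, the term $\nabla\Upsilon$ produced by differentiating $\Upsilon$ is
cancelled by the change of the Schouten tensor, $\widehat
Q_{ab}=Q_{ab}-\nabla_a\Upsilon_b+\Upsilon_a\Upsilon_b$ (`schouten_of_projChange`, `nabla_mid`,
`nabla_bot`).

Given $\sigma$, the condition $\partial^*d^\nabla s=0$ forces $v_a=\frac12\nabla_a\sigma$ from the
top slot and, as $w_{ab}$ is symmetric, $w_{ab}$ is the symmetric part of
$\frac12\nabla_a\nabla_b\sigma+Q_{ab}\sigma$. This tensor is already symmetric, because
$[\nabla_a,\nabla_b]\sigma=-2(Q_{ab}-Q_{ba})\sigma$ in weight two (`nabla_nabla_swap`). So the top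
slot and the whole middle slot of $d^\nabla L_0\sigma$ vanish, and the bottom slot is
$\widetilde{\mathcal D}\sigma$. Its invariance needs no further computation: every $\Upsilon$ term
in its transformation law multiplies a vanishing slot (`bot_eq_of_change`).

The Weyl-Cotton operator is taken to be $-3$ times the mixed part of $\widetilde{\mathcal D}$. It is
then invariant and killed by total symmetrisation; its formula follows by skewing
$\widetilde{\mathcal D}$ in its first two indices (`DtildeIn_sub_swap`).

The rest builds the calculus from a covariant derivative on vector fields: tensoriality of `covD`,
the Ricci identity `covD_covD_sub`, the Bianchi identity, and the one-form $\theta$ that represents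
the connection on densities relative to an arbitrary volume form, with
$d\theta_{ab}=(n+1)(Q_{ab}-Q_{ba})$. -/

namespace ProjectiveGeometry

open Bundle Topology Filter

section

variable {n : ℕ} {M : Type*} [TopologicalSpace M]
  [ChartedSpace (EuclideanSpace ℝ (Fin n)) M] [IsManifold (𝓡 n) ∞ M]

/-! ### Smooth vector fields, extensions of tangent vectors, local frames. -/

/-- A globally smooth vector field. -/
def SmoothVF (V : (y : M) → TangentSpace (𝓡 n) y) : Prop :=
  ContMDiff (𝓡 n) (𝓡 n).tangent ∞ (fun y => (⟨y, V y⟩ : TangentBundle (𝓡 n) M))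

/-- A vector field differentiable at `x`. -/
abbrev MDiffVF (V : (y : M) → TangentSpace (𝓡 n) y) (x : M) : Prop :=
  MDifferentiableAt (𝓡 n) (𝓡 n).tangent (fun y => (⟨y, V y⟩ : TangentBundle (𝓡 n) M)) x

variable (n) in
/-- A smooth real function. -/
abbrev SmoothFn (f : M → ℝ) : Prop := ContMDiff (𝓡 n) 𝓘(ℝ, ℝ) ∞ f

variable (n) in
/-- A real function differentiable at `x`. -/
abbrev MDiffFn (f : M → ℝ) (x : M) : Prop := MDifferentiableAt (𝓡 n) 𝓘(ℝ, ℝ) f x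

theorem SmoothVF.at {V : (y : M) → TangentSpace (𝓡 n) y} (h : SmoothVF V) (x : M) :
    SmoothVecAt V x := h x

theorem SmoothVF.mdiff {V : (y : M) → TangentSpace (𝓡 n) y} (h : SmoothVF V) (x : M) :
    MDiffVF V x := ContMDiffAt.mdifferentiableAt (h x) (by simp)

theorem SmoothVF.add {V W : (y : M) → TangentSpace (𝓡 n) y} (hV : SmoothVF V) (hW : SmoothVF W) :
    SmoothVF (V + W) := ContMDiff.add_section hV hW

theorem SmoothVF.sub {V W : (y : M) → TangentSpace (𝓡 n) y} (hV : SmoothVF V) (hW : SmoothVF W) :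
    SmoothVF (V - W) := ContMDiff.sub_section hV hW

theorem SmoothVF.smul {f : M → ℝ} {V : (y : M) → TangentSpace (𝓡 n) y} (hf : SmoothFn n f)
    (hV : SmoothVF V) : SmoothVF (f • V) := ContMDiff.smul_section hf hV

theorem mdiffAt_ext {x : M} (v : TangentSpace (𝓡 n) x) : MDiffVF (ext v) x :=
  FiberBundle.mdifferentiableAt_extend ..

@[simp] theorem ext_self {x : M} (v : TangentSpace (𝓡 n) x) : ext v x = v :=
  FiberBundle.extend_apply_self ..

/-- In the trivialization at `x` the field `ext v` is constant. Smoothness on the whole base set is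
what allows a cut-off by a bump function. -/
theorem contMDiffOn_ext {x : M} (v : TangentSpace (𝓡 n) x) :
    ContMDiffOn (𝓡 n) (𝓡 n).tangent ∞ (fun y => (⟨y, ext v y⟩ : TangentBundle (𝓡 n) M))
      (trivializationAt (EuclideanSpace ℝ (Fin n)) (TangentSpace (𝓡 n)) x).baseSet := by
  set t := trivializationAt (EuclideanSpace ℝ (Fin n)) (TangentSpace (𝓡 n) : M → Type _) x
  suffices ContMDiffOn (𝓡 n) 𝓘(ℝ, EuclideanSpace ℝ (Fin n)) ∞
      (fun y ↦ (t ⟨y, ext v y⟩).2) t.baseSet by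
    intro y hy
    rw [t.contMDiffWithinAt_section _ hy]
    exact this y hy
  have : ContMDiffOn (𝓡 n) 𝓘(ℝ, EuclideanSpace ℝ (Fin n)) ∞
      (fun _ : M ↦ (t ⟨x, v⟩).2) t.baseSet := contMDiffOn_const
  exact this.congr (fun y hy ↦ by
    have := congrArg Prod.snd (t.apply_mk_symm hy (t ⟨x, v⟩).2)
    exact this)

variable (n) in
/-- A bump function at `x`. -/
def bumpAt (x : M) : SmoothBumpFunction (𝓡 n) x := Classical.arbitrary _

/-- A globally smooth vector field with value `v` at `x`, agreeing near `x` with `ext v`. -/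
def gext {x : M} (v : TangentSpace (𝓡 n) x) : (y : M) → TangentSpace (𝓡 n) y :=
  (bumpAt n x : M → ℝ) • ext v

theorem gext_eventuallyEq {x : M} (v : TangentSpace (𝓡 n) x) :
    ∀ᶠ y in 𝓝 x, gext v y = ext v y := by
  filter_upwards [(bumpAt n x).eventuallyEq_one] with y hy
  simp [gext, hy]

@[simp] theorem gext_self {x : M} (v : TangentSpace (𝓡 n) x) : gext v x = v := by
  simp [gext]

variable [T2Space M]

theorem smoothVF_gext {x : M} (v : TangentSpace (𝓡 n) x) : SmoothVF (gext v) := by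
  refine ContMDiffOn.smul_section_of_tsupport (bumpAt n x).contMDiff.contMDiffOn
    (trivializationAt (EuclideanSpace ℝ (Fin n)) (TangentSpace (𝓡 n) : M → Type _) x).open_baseSet
    ?_ (contMDiffOn_ext v)
  rw [TangentBundle.trivializationAt_baseSet]
  exact (bumpAt n x).tsupport_subset_chartAt_source

/-- Near every point there are a frame of globally smooth vector fields and a dual coframe of
global one-forms. -/
theorem exists_frame (x : M) : ∃ (E : Fin n → (y : M) → TangentSpace (𝓡 n) y)
    (κ : Fin n → (y : M) → TangentSpace (𝓡 n) y →ₗ[ℝ] ℝ),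
    (∀ i, SmoothVF (E i)) ∧
    (∀ᶠ y in 𝓝 x, ∀ v : TangentSpace (𝓡 n) y, v = ∑ i, κ i y v • E i y) ∧
    (∀ᶠ y in 𝓝 x, ∀ i j, κ i y (E j y) = if i = j then 1 else 0) ∧
    (∀ i V, SmoothVecAt V x → ContMDiffAt (𝓡 n) 𝓘(ℝ, ℝ) ∞ (fun y => κ i y (V y)) x) ∧
    (∀ i (V : (y : M) → TangentSpace (𝓡 n) y), MDiffVF V x →
      MDiffFn n (fun y => κ i y (V y)) x) ∧
    (∀ i V, SmoothVF V → SmoothFn n (fun y => κ i y (V y))) := by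
  set t := trivializationAt (EuclideanSpace ℝ (Fin n)) (TangentSpace (𝓡 n) : M → Type _) x
  let b := (EuclideanSpace.basisFun (Fin n) ℝ).toBasis
  let ψ := bumpAt n x
  have hx : x ∈ t.baseSet := FiberBundle.mem_baseSet_trivializationAt' x
  have hψ : tsupport ψ ⊆ t.baseSet := by
    rw [TangentBundle.trivializationAt_baseSet]
    exact ψ.tsupport_subset_chartAt_source
  have h1 : ∀ᶠ y in 𝓝 x, ψ y = 1 := ψ.eventuallyEq_one
  have h2 : ∀ᶠ y in 𝓝 x, y ∈ t.baseSet := t.open_baseSet.mem_nhds hx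
  -- Frame and coframe are both cut off by `ψ`, so duality and the expansion of vectors hold only
  -- where `ψ = 1`, hence eventually near `x`.
  refine ⟨fun i => (ψ : M → ℝ) • t.localFrame b i,
    fun i y => ψ y • t.localFrameCoeff (𝓡 n) b i y, ?_, ?_, ?_, ?_, ?_, ?_⟩
  · intro i
    exact ContMDiffOn.smul_section_of_tsupport ψ.contMDiff.contMDiffOn t.open_baseSet hψ
      (t.contMDiffOn_localFrame_baseSet ∞ b i)
  · filter_upwards [h1, h2] with y hy hyt v
    have := Trivialization.eq_sum_localFrameCoeff_smul (I := 𝓡 n) (b := b) (s := ext v) hyt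
    simpa only [hy, Pi.smul_apply', one_smul, ext_self] using this
  · filter_upwards [h1, h2] with y hy hyt i j
    simp only [hy, Pi.smul_apply', one_smul]
    rw [t.localFrameCoeff_apply_of_mem_baseSet b hyt (t.localFrame b j) i]
    simp [hyt, Finsupp.single_apply, eq_comm]
  · intro i V hV
    have := contMDiffAt_localFrameCoeff (e := t) b hx hV i
    exact (ψ.contMDiff x).mul this
  · intro i V hV
    have := mdifferentiableAt_localFrameCoeff (e := t) b hx hV i
    exact ((ψ.contMDiff x).mdifferentiableAt (by simp)).mul this
  · intro i V hV y
    have hc : ContMDiffOn (𝓡 n) 𝓘(ℝ, ℝ) ∞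
        (fun y => t.localFrameCoeff (𝓡 n) b i y (V y)) t.baseSet :=
      fun z hz => (contMDiffAt_localFrameCoeff (e := t) b hz (hV z) i).contMDiffWithinAt
    -- Off the closed support the function vanishes near `y`, so the coefficients outside the chart
    -- play no role.
    by_cases hy : y ∈ tsupport ψ
    · exact (ψ.contMDiff y).mul ((hc.contMDiffAt (t.open_baseSet.mem_nhds (hψ hy))))
    · refine (contMDiffAt_const (c := (0 : ℝ))).congr_of_eventuallyEq ?_
      filter_upwards [(isClosed_tsupport ψ).isOpen_compl.mem_nhds hy] with z hz
      simp [image_eq_zero_of_notMem_tsupport hz]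

/-! ### Smoothness of tensor fields evaluated on vector fields. -/

/-- A pointwise multilinear field which is smooth on globally smooth vector fields is a tensor
field. -/
theorem isTensorField_of_smoothVF {k : ℕ} {T : RawField n M k}
    (hT : ∀ x : M, ∃ f : MultilinearMap ℝ (fun _ : Fin k => TangentSpace (𝓡 n) x) ℝ,
      ∀ v, T x v = f v)
    (hs : ∀ V : Fin k → (y : M) → TangentSpace (𝓡 n) y, (∀ i, SmoothVF (V i)) →
      SmoothFn n (fun y => T y (fun i => V i y))) : IsTensorField T where
  multilinear := hT
  smooth V x hV := by
    obtain ⟨E, κ, hE, hsum, -, hκ, -, -⟩ := exists_frame (n := n) x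
    choose f hf using hT
    -- Expanding every argument in the frame leaves values of `T` on globally smooth fields only,
    -- with smooth coefficients.
    have key : ContMDiffAt (𝓡 n) 𝓘(ℝ, ℝ) ∞
        (fun y => ∑ J : Fin k → Fin n, (∏ i, κ (J i) y (V i y)) * T y (fun i => E (J i) y)) x := by
      refine ContMDiffAt.sum fun J _ => ContMDiffAt.mul ?_ (hs _ (fun i => hE (J i)) x)
      exact ContMDiffAt.prod fun i _ => hκ _ _ (hV i)
    refine key.congr_of_eventuallyEq ?_
    filter_upwards [hsum] with y hy
    rw [hf, show (fun i => V i y) = fun i => ∑ j, κ j y (V i y) • E j y from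
      funext fun i => hy (V i y), MultilinearMap.map_sum]
    refine Finset.sum_congr rfl fun J _ => ?_
    rw [MultilinearMap.map_smul_univ, hf, smul_eq_mul]

theorem IsTensorField.smoothFn {k : ℕ} {T : RawField n M k} (hT : IsTensorField T)
    {V : Fin k → (y : M) → TangentSpace (𝓡 n) y} (hV : ∀ i, SmoothVF (V i)) :
    SmoothFn n (fun y => T y (fun i => V i y)) := fun x => hT.smooth V x fun i => hV i x

theorem IsTensorField.mdiff {k : ℕ} {T : RawField n M k} (hT : IsTensorField T)
    {V : Fin k → (y : M) → TangentSpace (𝓡 n) y} {x : M} (hV : ∀ i, SmoothVecAt (V i) x) :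
    MDiffFn n (fun y => T y (fun i => V i y)) x :=
  (hT.smooth V x hV).mdifferentiableAt (by simp)

/-- `TensorialAt` tests against fields that are merely differentiable, whereas tensor fields are
controlled on smooth ones; expanding the one slot in a smooth frame bridges the gap. -/
theorem IsTensorField.mdiff_update {k : ℕ} {T : RawField n M k} (hT : IsTensorField T)
    {V : Fin k → (y : M) → TangentSpace (𝓡 n) y} {x : M} (hV : ∀ i, SmoothVecAt (V i) x)
    (i : Fin k) {W : (y : M) → TangentSpace (𝓡 n) y} (hW : MDiffVF W x) :
    MDiffFn n (fun y => T y (Function.update (fun j => V j y) i (W y))) x := by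
  obtain ⟨E, κ, hE, hsum, -, -, hκ, -⟩ := exists_frame (n := n) x
  choose f hf using hT.multilinear
  have key : MDiffFn n (fun y => ∑ j, κ j y (W y) * T y (fun l => Function.update V i (E j) l y))
      x := by
    have := MDifferentiableAt.sum (t := Finset.univ) (I := 𝓡 n) (z := x)
      (f := fun j y => κ j y (W y) * T y (fun l => Function.update V i (E j) l y)) fun j _ => ?_
    · simpa [Finset.sum_fn] using this
    refine MDifferentiableAt.mul (hκ j W hW) (hT.mdiff fun l => ?_)
    rcases eq_or_ne l i with rfl | h
    · simpa using (hE j).at x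
    · simpa [h] using hV l
  refine key.congr_of_eventuallyEq ?_
  filter_upwards [hsum] with y hy
  conv_lhs => rw [hf, hy (W y), MultilinearMap.map_update_sum]
  refine Finset.sum_congr rfl fun j _ => ?_
  rw [MultilinearMap.map_update_smul, hf, smul_eq_mul]
  congr 2
  funext l
  by_cases h : l = i
  · subst h
    simp
  · simp [h]

theorem contMDiff_mvfderiv_apply {f : M → ℝ} (hf : SmoothFn n f)
    {V : (y : M) → TangentSpace (𝓡 n) y} (hV : SmoothVF V) :
    SmoothFn n (fun y => mvfderiv (𝓡 n) f y (V y)) := by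
  have h1 := hf.contMDiff_tangentMap (m := ∞) (by simp)
  have h2 := h1.comp hV
  exact (contMDiff_snd_tangentBundle_modelSpace ℝ 𝓘(ℝ, ℝ)).comp h2

/-! ### Affine connections and tensoriality of the covariant derivative. -/

namespace AffineConn

variable (D : AffineConn n M)

theorem smoothVF_cov {V W : (y : M) → TangentSpace (𝓡 n) y} (hV : SmoothVF V) (hW : SmoothVF W) :
    SmoothVF (fun y => D.cov W y (V y)) := by
  have h := D.smooth.contMDiff.contMDiff (σ := W) hW.contMDiffOn
  exact ContMDiff.clm_bundle_apply (contMDiffOn_univ.1 h) hV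

theorem mlieBracket_eq {V W : (y : M) → TangentSpace (𝓡 n) y} {x : M} (hV : MDiffVF V x)
    (hW : MDiffVF W x) :
    VectorField.mlieBracket (𝓡 n) V W x = D.cov W x (V x) - D.cov V x (W x) :=
  ((CovariantDerivative.torsion_eq_zero_iff _).1 D.torsion_free hV hW).symm

theorem cov_congr {V W : (y : M) → TangentSpace (𝓡 n) y} {x : M} (hV : MDiffVF V x)
    (hW : MDiffVF W x) (h : ∀ᶠ y in 𝓝 x, V y = W y) : D.cov V x = D.cov W x :=
  D.cov.isCovariantDerivativeOn.congr_of_eventuallyEq (s := Set.univ) hV hW univ_mem h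

end AffineConn

theorem update_vectorField_apply {ι : Type*} [DecidableEq ι]
    (V : ι → (y : M) → TangentSpace (𝓡 n) y) (i : ι) (W : (y : M) → TangentSpace (𝓡 n) y) (y : M) :
    (fun j => Function.update V i W j y) = Function.update (fun j => V j y) i (W y) := by
  funext j
  by_cases h : j = i
  · subst h
    simp
  · simp [h]

namespace AffineConn

variable (D : AffineConn n M)

/-- The covariant derivative of `T` along `u`, computed with the vector fields `V`. -/
def covOn {k : ℕ} (T : RawField n M k) (x : M) (u : TangentSpace (𝓡 n) x)
    (V : Fin k → (y : M) → TangentSpace (𝓡 n) y) : ℝ :=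
  mvfderiv (𝓡 n) (fun y => T y (fun i => V i y)) x u
    - ∑ i : Fin k, T x (Function.update (fun j => V j x) i (D.cov (V i) x u))

/-- This isolates how `W` enters: its first derivative occurs in the first two terms only, and the
remaining sum sees just `W x`. -/
theorem covOn_update {k : ℕ} (T : RawField n M k) (x : M) (u : TangentSpace (𝓡 n) x)
    (V : Fin k → (y : M) → TangentSpace (𝓡 n) y) (i : Fin k)
    (W : (y : M) → TangentSpace (𝓡 n) y) :
    D.covOn T x u (Function.update V i W) =
      mvfderiv (𝓡 n) (fun y => T y (Function.update (fun j => V j y) i (W y))) x u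
        - T x (Function.update (fun j => V j x) i (D.cov W x u))
        - ∑ j ∈ Finset.univ.erase i, T x (Function.update
            (Function.update (fun j => V j x) j (D.cov (V j) x u)) i (W x)) := by
  simp only [covOn, update_vectorField_apply]
  rw [← Finset.add_sum_erase _ _ (Finset.mem_univ i), sub_sub]
  congr 2
  · simp
  · refine Finset.sum_congr rfl fun j hj => ?_
    have hj' : j ≠ i := Finset.ne_of_mem_erase hj
    rw [Function.update_comm hj', Function.update_of_ne hj']

/-- Replacing `W` by `f • W` produces `df(u)` times `T` twice, once from differentiating the
function and once from the Leibniz rule for `D.cov`, with opposite signs. -/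
theorem tensorialAt_covOn {k : ℕ} {T : RawField n M k} (hT : IsTensorField T) {x : M}
    (u : TangentSpace (𝓡 n) x) {V : Fin k → (y : M) → TangentSpace (𝓡 n) y}
    (hV : ∀ i, SmoothVecAt (V i) x) (i : Fin k) :
    TensorialAt (𝓡 n) (EuclideanSpace ℝ (Fin n))
      (fun W => D.covOn T x u (Function.update V i W)) x where
  smul {f W} hf hW := by
    obtain ⟨g, hg⟩ := hT.multilinear x
    have h1 : (fun y => T y (Function.update (fun j => V j y) i ((f • W) y))) =
        fun y => f y * T y (Function.update (fun j => V j y) i (W y)) := by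
      funext y
      obtain ⟨g, hg⟩ := hT.multilinear y
      simp [hg]
    rw [covOn_update, covOn_update, h1, mvfderiv_fun_mul hf (hT.mdiff_update hV i hW),
      D.cov.isCovariantDerivativeOnUniv.leibniz hW hf]
    simp [hg, mul_sub, Finset.mul_sum]
    ring
  add {W W'} hW hW' := by
    obtain ⟨g, hg⟩ := hT.multilinear x
    have h1 : (fun y => T y (Function.update (fun j => V j y) i ((W + W') y))) =
        fun y => T y (Function.update (fun j => V j y) i (W y)) +
          T y (Function.update (fun j => V j y) i (W' y)) := by
      funext y
      obtain ⟨g, hg⟩ := hT.multilinear y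
      simp [hg]
    rw [covOn_update, covOn_update, covOn_update, h1,
      mvfderiv_fun_add (hT.mdiff_update hV i hW) (hT.mdiff_update hV i hW'),
      D.cov.isCovariantDerivativeOnUniv.add hW hW']
    simp [hg, Finset.sum_add_distrib]
    ring

/-- Tensoriality handles one slot, so the fields are exchanged one at a time, by induction on the
set of slots already exchanged. -/
theorem covOn_congr {k : ℕ} {T : RawField n M k} (hT : IsTensorField T) {x : M}
    (u : TangentSpace (𝓡 n) x) {V V' : Fin k → (y : M) → TangentSpace (𝓡 n) y}
    (hV : ∀ i, SmoothVecAt (V i) x) (hV' : ∀ i, SmoothVecAt (V' i) x) (h : ∀ i, V i x = V' i x) :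
    D.covOn T x u V = D.covOn T x u V' := by
  have key : ∀ S : Finset (Fin k), D.covOn T x u (fun i => if i ∈ S then V' i else V i) =
      D.covOn T x u V := by
    intro S
    induction S using Finset.induction_on with
    | empty => simp
    | insert a S ha ih =>
      set U : Fin k → (y : M) → TangentSpace (𝓡 n) y := fun i => if i ∈ S then V' i else V i with hU
      have hUs : ∀ i, SmoothVecAt (U i) x := fun i => by
        by_cases hi : i ∈ S
        · simpa [hU, hi] using hV' i
        · simpa [hU, hi] using hV i
      have e1 : (fun i => if i ∈ insert a S then V' i else V i) = Function.update U a (V' a) := by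
        funext i
        by_cases hi : i = a
        · subst hi
          simp
        · simp [hU, hi]
      have e2 : U = Function.update U a (V a) := by
        conv_lhs => rw [← Function.update_eq_self a U]
        simp [hU, ha]
      rw [e1, ← ih]
      conv_rhs => rw [e2]
      exact ((D.tensorialAt_covOn hT u hUs a).pointwise
        ((hV a).mdifferentiableAt (by simp)) ((hV' a).mdifferentiableAt (by simp)) (h a)).symm
  have := key Finset.univ
  simpa using this.symm

theorem smoothVecAt_ext {x : M} (v : TangentSpace (𝓡 n) x) : SmoothVecAt (ext v) x :=
  FiberBundle.contMDiffAt_extend ..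

theorem covD_eq_covOn {k : ℕ} {T : RawField n M k} (hT : IsTensorField T) {x : M}
    (u : TangentSpace (𝓡 n) x) {V : Fin k → (y : M) → TangentSpace (𝓡 n) y}
    (hV : ∀ i, SmoothVecAt (V i) x) :
    D.covD T x (Fin.cons u (fun i => V i x)) = D.covOn T x u V := by
  rw [← D.covOn_congr hT u (V := fun i => ext (V i x)) (fun i => smoothVecAt_ext _) hV
    (fun i => ext_self _)]
  simp [covD, covOn]

theorem covOn_add_left {k : ℕ} {T : RawField n M k} (hT : IsTensorField T) {x : M}
    (u u' : TangentSpace (𝓡 n) x) (V : Fin k → (y : M) → TangentSpace (𝓡 n) y) :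
    D.covOn T x (u + u') V = D.covOn T x u V + D.covOn T x u' V := by
  obtain ⟨f, hf⟩ := hT.multilinear x
  simp only [covOn, hf, map_add, MultilinearMap.map_update_add, Finset.sum_add_distrib]
  ring

theorem covOn_smul_left {k : ℕ} {T : RawField n M k} (hT : IsTensorField T) {x : M}
    (c : ℝ) (u : TangentSpace (𝓡 n) x) (V : Fin k → (y : M) → TangentSpace (𝓡 n) y) :
    D.covOn T x (c • u) V = c * D.covOn T x u V := by
  obtain ⟨f, hf⟩ := hT.multilinear x
  simp only [covOn, hf, map_smul, MultilinearMap.map_update_smul, smul_eq_mul, ← Finset.mul_sum]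
  ring

theorem covD_update_zero {k : ℕ} (T : RawField n M k) {x : M}
    (v : Fin (k + 1) → TangentSpace (𝓡 n) x) (a : TangentSpace (𝓡 n) x) :
    D.covD T x (Function.update v 0 a) = D.covOn T x a (fun i => ext (v i.succ)) := by
  simp [covD, covOn, Fin.tail]
  rfl

theorem covD_update_succ {k : ℕ} {T : RawField n M k} (hT : IsTensorField T) {x : M}
    (v : Fin (k + 1) → TangentSpace (𝓡 n) x) (i : Fin k) {W : (y : M) → TangentSpace (𝓡 n) y}
    (hW : SmoothVecAt W x) :
    D.covD T x (Function.update v i.succ (W x)) =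
      D.covOn T x (v 0) (Function.update (fun j => ext (v j.succ)) i W) := by
  rw [← D.covD_eq_covOn hT]
  · congr 1
    funext j
    refine Fin.cases ?_ (fun j => ?_) j
    · simp [Function.update_of_ne (Fin.succ_ne_zero i).symm]
    · by_cases h : j = i
      · subst h
        simp
      · simp [h]
  · intro j
    by_cases h : j = i
    · subst h
      simpa using hW
    · simpa [h] using smoothVecAt_ext _

/-- Linearity in slot `0` is visible in `covOn`; in the other slots it is tensoriality. For
smoothness, independence of the extension permits the given global fields in place of the pointwise
`ext`. -/
theorem isTensorField_covD {k : ℕ} {T : RawField n M k} (hT : IsTensorField T) :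
    IsTensorField (D.covD T) := by
  refine isTensorField_of_smoothVF (fun x => ?_) fun V hV => ?_
  · refine ⟨{ toFun := D.covD T x, map_update_add' := ?_, map_update_smul' := ?_ }, fun _ => rfl⟩
    · intro inst v i a b
      obtain rfl : inst = instDecidableEqFin (k + 1) := Subsingleton.elim _ _
      refine Fin.cases ?_ (fun i => ?_) i
      · simp only [covD_update_zero, D.covOn_add_left hT]
      · have h := D.covD_update_succ hT v i ((smoothVecAt_ext a).add_section (smoothVecAt_ext b))
        simp only [Pi.add_apply, ext_self] at h
        rw [h, (D.tensorialAt_covOn hT (v 0) (fun _ => smoothVecAt_ext _) i).add (mdiffAt_ext a)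
          (mdiffAt_ext b), ← D.covD_update_succ hT v i (smoothVecAt_ext a),
          ← D.covD_update_succ hT v i (smoothVecAt_ext b), ext_self, ext_self]
    · intro inst v i c a
      obtain rfl : inst = instDecidableEqFin (k + 1) := Subsingleton.elim _ _
      refine Fin.cases ?_ (fun i => ?_) i
      · simp only [covD_update_zero, D.covOn_smul_left hT, smul_eq_mul]
      · have h := D.covD_update_succ hT v i
          (W := (fun _ => c : M → ℝ) • ext a) (contMDiffAt_const.smul_section (smoothVecAt_ext a))
        simp only [Pi.smul_apply', ext_self] at h
        rw [h, (D.tensorialAt_covOn hT (v 0) (fun _ => smoothVecAt_ext _) i).smul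
          mdifferentiableAt_const (mdiffAt_ext a), ← D.covD_update_succ hT v i (smoothVecAt_ext a),
          ext_self]
  · have h : (fun y => D.covD T y (fun i => V i y)) =
        fun y => D.covOn T y (V 0 y) (Fin.tail V) := by
      funext y
      rw [← D.covD_eq_covOn hT (V 0 y) (V := Fin.tail V) fun i => (hV i.succ).at y]
      congr 1
      funext i
      refine Fin.cases ?_ (fun i => ?_) i <;> simp [Fin.tail]
    rw [h]
    refine ContMDiff.sub (contMDiff_mvfderiv_apply (hT.smoothFn fun i => hV i.succ) (hV 0))
      (ContMDiff.sum fun i _ => ?_)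
    have := hT.smoothFn (V := Function.update (Fin.tail V) i
      (fun y => D.cov (Fin.tail V i) y (V 0 y))) fun j => ?_
    · simpa only [update_vectorField_apply] using this
    · by_cases hj : j = i
      · subst hj
        simpa [Fin.tail] using D.smoothVF_cov (hV 0) (hV j.succ)
      · simpa [hj, Fin.tail] using hV j.succ

end AffineConn

/-! ### Commutators of derivations, curvature and the Ricci identity. -/

theorem mvfderiv_fun_sum {ι : Type} {s : Finset ι} {f : ι → M → ℝ} {x : M}
    (hf : ∀ i ∈ s, MDiffFn n (f i) x) :
    mvfderiv (𝓡 n) (fun y => ∑ i ∈ s, f i y) x = ∑ i ∈ s, mvfderiv (𝓡 n) (f i) x := by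
  classical
  induction s using Finset.induction_on with
  | empty => simpa using mvfderiv_const (I := 𝓡 n) (0 : ℝ) (x := x)
  | insert a s ha ih =>
    have h : MDiffFn n (fun y => ∑ i ∈ s, f i y) x := by
      have : MDifferentiableAt (𝓡 n) 𝓘(ℝ, ℝ) (∑ i ∈ s, f i) x :=
        MDifferentiableAt.sum fun i hi => hf i (Finset.mem_insert_of_mem hi)
      simpa [Finset.sum_fn] using this
    simp only [Finset.sum_insert ha]
    rw [mvfderiv_fun_add (hf a (Finset.mem_insert_self a s)) h,
      ih fun i hi => hf i (Finset.mem_insert_of_mem hi)]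

namespace AffineConn

variable (D : AffineConn n M)

theorem smoothVF_mlieBracket {U V : (y : M) → TangentSpace (𝓡 n) y} (hU : SmoothVF U)
    (hV : SmoothVF V) : SmoothVF (VectorField.mlieBracket (𝓡 n) U V) := by
  have : IsManifold (𝓡 n) (minSmoothness ℝ 2) M := by
    simp only [minSmoothness_of_isRCLikeNormedField]
    infer_instance
  have : IsManifold (𝓡 n) (minSmoothness ℝ 3) M := by
    simp only [minSmoothness_of_isRCLikeNormedField]
    infer_instance
  have : IsManifold (𝓡 n) (((⊤ : ℕ∞) : WithTop ℕ∞) + 1) M := by simpa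
  exact ContDiff.mlieBracket_vectorField (m := ⊤) (n := ⊤) hU hV (by simp)

end AffineConn

theorem mlieBracket_jacobi {U V W : (y : M) → TangentSpace (𝓡 n) y} (hU : SmoothVF U)
    (hV : SmoothVF V) (hW : SmoothVF W) (x : M) :
    VectorField.mlieBracket (𝓡 n) U (VectorField.mlieBracket (𝓡 n) V W) x =
      VectorField.mlieBracket (𝓡 n) (VectorField.mlieBracket (𝓡 n) U V) W x +
        VectorField.mlieBracket (𝓡 n) V (VectorField.mlieBracket (𝓡 n) U W) x := by
  have : IsManifold (𝓡 n) (minSmoothness ℝ 3) M := by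
    simp only [minSmoothness_of_isRCLikeNormedField]
    infer_instance
  have h2 : minSmoothness ℝ 2 ≤ ∞ := by
    simp only [minSmoothness_of_isRCLikeNormedField]
    exact ENat.LEInfty.out
  exact VectorField.leibniz_identity_mlieBracket_apply ((hU x).of_le h2) ((hV x).of_le h2)
    ((hW x).of_le h2)

theorem mlieBracket_smul_right' {f : M → ℝ} (hf : SmoothFn n f)
    {V W : (y : M) → TangentSpace (𝓡 n) y} (hW : SmoothVF W) :
    VectorField.mlieBracket (𝓡 n) V (f • W) =
      (fun y => mvfderiv (𝓡 n) f y (V y)) • W + f • VectorField.mlieBracket (𝓡 n) V W := by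
  funext x
  rw [VectorField.mlieBracket_smul_right ((hf x).mdifferentiableAt (by simp)) (hW.mdiff x)]
  rfl

/-- `U (V f) - V (U f) = [U, V] f`. -/
theorem mvfderiv_commutator {f : M → ℝ} (hf : SmoothFn n f)
    {U V : (y : M) → TangentSpace (𝓡 n) y} (hU : SmoothVF U) (hV : SmoothVF V) (x : M) :
    mvfderiv (𝓡 n) (fun y => mvfderiv (𝓡 n) f y (V y)) x (U x)
      - mvfderiv (𝓡 n) (fun y => mvfderiv (𝓡 n) f y (U y)) x (V x) =
      mvfderiv (𝓡 n) f x (VectorField.mlieBracket (𝓡 n) U V x) := by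
  -- The identity is read off as the coefficient of a nonzero vector; if there is none, all three
  -- terms are derivatives along `0`.
  by_cases hw : ∃ w : TangentSpace (𝓡 n) x, w ≠ 0
  · obtain ⟨w, hw⟩ := hw
    have hW := smoothVF_gext w
    have hfU := contMDiff_mvfderiv_apply hf hU
    have hfV := contMDiff_mvfderiv_apply hf hV
    -- In the Jacobi identity for `U`, `V`, `f • W`, subtracting `f` times that for `U`, `V`, `W`
    -- leaves `(U V f - V U f - [U, V] f) • W = 0`, since the terms with one derivative of `f`
    -- cancel.
    have J := mlieBracket_jacobi hU hV (SmoothVF.smul hf hW) x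
    have J' := mlieBracket_jacobi hU hV hW x
    have hUW := AffineConn.smoothVF_mlieBracket hU hW
    have hVW := AffineConn.smoothVF_mlieBracket hV hW
    rw [mlieBracket_smul_right' hf hW, mlieBracket_smul_right' hf hW, mlieBracket_smul_right' hf hW,
      VectorField.mlieBracket_add_right ((SmoothVF.smul hfV hW).mdiff x)
        ((SmoothVF.smul hf hVW).mdiff x),
      VectorField.mlieBracket_add_right ((SmoothVF.smul hfU hW).mdiff x)
        ((SmoothVF.smul hf hUW).mdiff x), mlieBracket_smul_right' hfV hW,
      mlieBracket_smul_right' hfU hW, mlieBracket_smul_right' hf hUW,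
      mlieBracket_smul_right' hf hVW] at J
    simp only [Pi.add_apply, Pi.smul_apply', gext_self, J', smul_add] at J
    have : (mvfderiv (𝓡 n) (fun y => mvfderiv (𝓡 n) f y (V y)) x (U x)
      - mvfderiv (𝓡 n) (fun y => mvfderiv (𝓡 n) f y (U y)) x (V x)
      - mvfderiv (𝓡 n) f x (VectorField.mlieBracket (𝓡 n) U V x)) • w = 0 := by
      rw [sub_smul, sub_smul]
      rw [← sub_eq_zero] at J
      rw [← J]
      abel
    rcases smul_eq_zero.1 this with h | h
    · linarith
    · exact absurd h hw
  · push Not at hw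
    rw [hw (U x), hw (V x), hw (VectorField.mlieBracket (𝓡 n) U V x)]
    simp

namespace AffineConn

variable (D : AffineConn n M)

/-- The curvature operator on vector fields. -/
def curvOn (U V W : (y : M) → TangentSpace (𝓡 n) y) (x : M) : TangentSpace (𝓡 n) x :=
  D.cov (fun y => D.cov W y (V y)) x (U x) - D.cov (fun y => D.cov W y (U y)) x (V x)
    - D.cov W x (VectorField.mlieBracket (𝓡 n) U V x)

theorem mdiffVF_congr {V W : (y : M) → TangentSpace (𝓡 n) y} {x : M} (hV : MDiffVF V x)
    (h : ∀ᶠ y in 𝓝 x, W y = V y) : MDiffVF W x := by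
  refine MDifferentiableAt.congr_of_eventuallyEq hV ?_
  filter_upwards [h] with y hy
  rw [hy]

theorem cov_ext_eventuallyEq {x : M} (v w : TangentSpace (𝓡 n) x) :
    ∀ᶠ y in 𝓝 x, D.cov (ext w) y (ext v y) = D.cov (gext w) y (gext v y) := by
  filter_upwards [gext_eventuallyEq v, (gext_eventuallyEq w).eventually_nhds] with y hv hw
  rw [hv, D.cov_congr (mdiffVF_congr ((smoothVF_gext w).mdiff y) (hw.mono fun z hz => hz.symm))
    ((smoothVF_gext w).mdiff y) (hw.mono fun z hz => hz.symm)]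

/-- Curvature depends only on germs, and `gext` agrees with `ext` near `x`; with global smooth
fields the iterated derivatives need no further localisation. -/
theorem curv_eq_curvOn (x : M) (u v w : TangentSpace (𝓡 n) x) :
    D.curv x u v w = D.curvOn (gext u) (gext v) (gext w) x := by
  have hs : ∀ a : TangentSpace (𝓡 n) x, MDiffVF (fun y => D.cov (gext w) y (gext a y)) x := fun a =>
    (D.smoothVF_cov (smoothVF_gext a) (smoothVF_gext w)).mdiff x
  have h : ∀ a : TangentSpace (𝓡 n) x, D.cov (fun y => D.cov (ext w) y (ext a y)) x =
      D.cov (fun y => D.cov (gext w) y (gext a y)) x := fun a =>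
    D.cov_congr (mdiffVF_congr (hs a) (D.cov_ext_eventuallyEq a w)) (hs a)
      (D.cov_ext_eventuallyEq a w)
  have hb : VectorField.mlieBracket (𝓡 n) (ext u) (ext v) x =
      VectorField.mlieBracket (𝓡 n) (gext u) (gext v) x :=
    EventuallyEq.mlieBracket_vectorField_eq ((gext_eventuallyEq u).mono fun y hy => hy.symm)
      ((gext_eventuallyEq v).mono fun y hy => hy.symm)
  rw [curv, curvOn, h, h, hb, gext_self, gext_self,
    D.cov_congr (mdiffAt_ext w) ((smoothVF_gext w).mdiff x)
      ((gext_eventuallyEq w).mono fun y hy => hy.symm)]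

/-- The terms are sorted by their behaviour under exchange of `U` and `V`: the two single sums of
derivatives swap, the double sum is symmetric, and the other terms give the commutator, the torsion
and the curvature. -/
theorem covD_covD_eq {k : ℕ} {T : RawField n M k} (hT : IsTensorField T) (x : M)
    {U V : (y : M) → TangentSpace (𝓡 n) y} {W : Fin k → (y : M) → TangentSpace (𝓡 n) y}
    (hU : SmoothVF U) (hV : SmoothVF V) (hW : ∀ i, SmoothVF (W i)) :
    D.covD (D.covD T) x (Fin.cons (U x) (Fin.cons (V x) fun i => W i x)) =
      mvfderiv (𝓡 n) (fun y => mvfderiv (𝓡 n) (fun z => T z fun i => W i z) y (V y)) x (U x)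
      - ∑ i, mvfderiv (𝓡 n) (fun y => T y (Function.update (fun j => W j y) i
          (D.cov (W i) y (V y)))) x (U x)
      - ∑ i, mvfderiv (𝓡 n) (fun y => T y (Function.update (fun j => W j y) i
          (D.cov (W i) y (U y)))) x (V x)
      - D.covOn T x (D.cov V x (U x)) W
      + ∑ i, T x (Function.update (fun j => W j x) i
          (D.cov (fun y => D.cov (W i) y (U y)) x (V x)))
      + ∑ i, ∑ j ∈ Finset.univ.erase i, T x (Function.update
          (Function.update (fun j => W j x) j (D.cov (W j) x (V x))) i (D.cov (W i) x (U x))) := by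
  have hWU : ∀ i, SmoothVF (fun y => D.cov (W i) y (U y)) := fun i => D.smoothVF_cov hU (hW i)
  have hWV : ∀ i, SmoothVF (fun y => D.cov (W i) y (V y)) := fun i => D.smoothVF_cov hV (hW i)
  have hup : ∀ i (X : (y : M) → TangentSpace (𝓡 n) y), SmoothVF X → ∀ j,
      SmoothVF (Function.update W i X j) := fun i X hX j => by
    by_cases h : j = i
    · subst h
      simpa using hX
    · simpa [h] using hW j
  have hTup : ∀ i, SmoothFn n (fun y => T y (Function.update (fun j => W j y) i
          (D.cov (W i) y (V y)))) := fun i => by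
    simpa only [update_vectorField_apply] using hT.smoothFn (hup i _ (hWV i))
  have hcons : ∀ y, (fun i => (Fin.cons V W : Fin (k + 1) → (y : M) → TangentSpace (𝓡 n) y) i y) =
      Fin.cons (V y) (fun i => W i y) := fun y => by
    funext i
    refine Fin.cases ?_ (fun i => ?_) i <;> simp
  have h1 := D.covD_eq_covOn (D.isTensorField_covD hT) (U x) (x := x)
    (V := Fin.cons V W) (fun i => by
      refine Fin.cases ?_ (fun i => ?_) i
      · exact hV x
      · exact hW i x)
  simp only [hcons] at h1
  rw [h1, covOn]
  simp only [hcons, Fin.sum_univ_succ, Fin.cons_zero, Fin.cons_succ]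
  have e0 : ∀ y a, D.covD T y (Fin.cons a fun i => W i y) = D.covOn T y a W := fun y a =>
    D.covD_eq_covOn hT a fun i => hW i y
  have e1 : ∀ i, D.covD T x (Function.update (Fin.cons (V x) fun i => W i x) (Fin.succ i)
      (D.cov (W i) x (U x))) =
      D.covOn T x (V x) (Function.update W i (fun y => D.cov (W i) y (U y))) := fun i => by
    rw [← D.covD_eq_covOn hT _ fun j => hup i _ (hWU i) j x, update_vectorField_apply,
      Fin.cons_update]
  simp only [Fin.update_cons_zero, e0, e1, covOn_update]
  have e2 : mvfderiv (𝓡 n) (fun y => D.covOn T y (V y) W) x (U x) =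
      mvfderiv (𝓡 n) (fun y => mvfderiv (𝓡 n) (fun z => T z fun i => W i z) y (V y)) x (U x)
      - ∑ i, mvfderiv (𝓡 n) (fun y => T y (Function.update (fun j => W j y) i
          (D.cov (W i) y (V y)))) x (U x) := by
    simp only [covOn]
    have hm : ∀ i, MDiffFn n (fun y => T y (Function.update (fun j => W j y) i
          (D.cov (W i) y (V y)))) x := fun i => (hTup i x).mdifferentiableAt (by simp)
    rw [mvfderiv_fun_sub ((contMDiff_mvfderiv_apply (hT.smoothFn hW) hV x).mdifferentiableAt
      (by simp)) ((ContMDiff.sum (t := Finset.univ) (fun i _ => hTup i) x).mdifferentiableAt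
        (by simp)), mvfderiv_fun_sum fun i _ => hm i]
    simp
  rw [e2]
  simp only [Finset.sum_sub_distrib]
  ring

/-- The Ricci identity. -/
theorem covD_covD_sub {k : ℕ} {T : RawField n M k} (hT : IsTensorField T) (x : M)
    (u v : TangentSpace (𝓡 n) x) (e : Fin k → TangentSpace (𝓡 n) x) :
    D.covD (D.covD T) x (Fin.cons u (Fin.cons v e))
        - D.covD (D.covD T) x (Fin.cons v (Fin.cons u e))
      = - ∑ i, T x (Function.update e i (D.curv x u v (e i))) := by
  obtain ⟨f, hf⟩ := hT.multilinear x
  have hU := smoothVF_gext u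
  have hV := smoothVF_gext v
  have hW : ∀ i, SmoothVF (gext (e i)) := fun i => smoothVF_gext _
  have h1 := D.covD_covD_eq hT x hU hV hW
  have h2 := D.covD_covD_eq hT x hV hU hW
  have hb := D.mlieBracket_eq (hU.mdiff x) (hV.mdiff x)
  have hc := mvfderiv_commutator (hT.smoothFn hW) hU hV x
  -- Two distinct slots are differentiated, one along `u` and one along `v`, so renaming the slots
  -- exchanges `u` and `v`.
  have hS : ∑ i, ∑ j ∈ Finset.univ.erase i, T x (Function.update
          (Function.update e j (D.cov (gext (e j)) x v)) i (D.cov (gext (e i)) x u)) =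
      ∑ i, ∑ j ∈ Finset.univ.erase i, T x (Function.update
          (Function.update e j (D.cov (gext (e j)) x u)) i (D.cov (gext (e i)) x v)) := by

    simp only [← Finset.filter_ne, Finset.sum_filter]
    rw [Finset.sum_comm]
    refine Finset.sum_congr rfl fun i _ => Finset.sum_congr rfl fun j _ => ?_
    by_cases h : i = j
    · simp [h]
    · simp only [ne_eq, h, Ne.symm h, not_false_eq_true, if_true]
      rw [Function.update_comm h]
  simp only [gext_self] at h1 h2 hb hc
  rw [h1, h2, hS]
  simp only [D.curv_eq_curvOn, curvOn, hb, gext_self, hf, map_sub, MultilinearMap.map_update_sub,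
    Finset.sum_sub_distrib, covOn] at hc ⊢
  linarith

end AffineConn

/-! ### Algebra of tensor fields, Leibniz rules, projective change of `covD`. -/

namespace IsTensorField

theorem add {k : ℕ} {S T : RawField n M k} (hS : IsTensorField S) (hT : IsTensorField T) :
    IsTensorField (fun x v => S x v + T x v : RawField n M k) where
  multilinear x := by
    obtain ⟨f, hf⟩ := hS.multilinear x
    obtain ⟨g, hg⟩ := hT.multilinear x
    exact ⟨f + g, fun v => by simp [hf, hg]⟩
  smooth V x hV := (hS.smooth V x hV).add (hT.smooth V x hV)

theorem const_mul {k : ℕ} {T : RawField n M k} (c : ℝ) (hT : IsTensorField T) :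
    IsTensorField (fun x v => c * T x v : RawField n M k) where
  multilinear x := by
    obtain ⟨g, hg⟩ := hT.multilinear x
    exact ⟨c • g, fun v => by simp [hg]⟩
  smooth V x hV := contMDiffAt_const.mul (hT.smooth V x hV)

theorem sub {k : ℕ} {S T : RawField n M k} (hS : IsTensorField S) (hT : IsTensorField T) :
    IsTensorField (fun x v => S x v - T x v : RawField n M k) := by
  simpa [sub_eq_add_neg] using hS.add (hT.const_mul (-1))

theorem sum {k : ℕ} {ι : Type*} {s : Finset ι} {T : ι → RawField n M k}
    (hT : ∀ i ∈ s, IsTensorField (T i)) :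
    IsTensorField (fun x v => ∑ i ∈ s, T i x v : RawField n M k) := by
  classical
  induction s using Finset.induction_on with
  | empty => simpa using isTensorField_zero
  | insert a s ha ih =>
    simp only [Finset.sum_insert ha]
    exact (hT a (Finset.mem_insert_self a s)).add
      (ih fun i hi => hT i (Finset.mem_insert_of_mem hi))

theorem perm {k : ℕ} {T : RawField n M k} (hT : IsTensorField T) (ρ : Equiv.Perm (Fin k)) :
    IsTensorField (fun x v => T x (fun i => v (ρ i)) : RawField n M k) where
  multilinear x := by
    obtain ⟨g, hg⟩ := hT.multilinear x
    exact ⟨g.domDomCongr ρ, fun v => by simp [hg]⟩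
  smooth V x hV := hT.smooth (fun i => V (ρ i)) x fun i => hV (ρ i)

/-- The product of a one-form with a covariant tensor. -/
theorem tmul {k : ℕ} {S : RawField n M 1} {T : RawField n M k} (hS : IsTensorField S)
    (hT : IsTensorField T) :
    IsTensorField (fun x v => S x ![v 0] * T x (Fin.tail v) : RawField n M (k + 1)) where
  multilinear x := by
    obtain ⟨f, hf⟩ := hS.multilinear x
    obtain ⟨g, hg⟩ := hT.multilinear x
    have hf' : ∀ a, S x ![a] = (f.curryLeft a) ![] := fun a => by
      rw [hf, MultilinearMap.curryLeft_apply]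
      congr 1
    exact ⟨LinearMap.uncurryLeft
      { toFun := fun a => S x ![a] • g
        map_add' := fun a b => by simp [hf', add_smul]
        map_smul' := fun c a => by simp [hf', mul_smul] }, fun v => by
        simp [LinearMap.uncurryLeft_apply, hg]⟩
  smooth V x hV := by
    refine ContMDiffAt.mul ?_ (hT.smooth (Fin.tail V) x fun i => hV i.succ)
    have := hS.smooth ![V 0] x (fun i => by fin_cases i; exact hV 0)
    refine this.congr_of_eventuallyEq (Eventually.of_forall fun y => ?_)
    change S y _ = S y _
    congr 1
    funext i
    fin_cases i
    rfl

theorem smul {k : ℕ} {f : M → ℝ} {T : RawField n M k} (hf : SmoothFn n f)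
    (hT : IsTensorField T) : IsTensorField (fun x v => f x * T x v : RawField n M k) where
  multilinear x := by
    obtain ⟨g, hg⟩ := hT.multilinear x
    exact ⟨f x • g, fun v => by simp [hg]⟩
  smooth V x hV := (hf x).mul (hT.smooth V x hV)

theorem smoothFn_zero {T : RawField n M 0} (hT : IsTensorField T) : SmoothFn n (fun y => T y ![]) :=
  fun x => by
    refine (hT.smooth ![] x (fun i => i.elim0)).congr_of_eventuallyEq
      (Eventually.of_forall fun y => ?_)
    change T y _ = T y _
    congr 1
    funext i
    exact i.elim0

theorem mdiff_ext {k : ℕ} {T : RawField n M k} (hT : IsTensorField T) {x : M}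
    (v : Fin k → TangentSpace (𝓡 n) x) : MDiffFn n (fun y => T y (fun i => ext (v i) y)) x :=
  hT.mdiff fun i => AffineConn.smoothVecAt_ext (v i)

end IsTensorField

namespace AffineConn

variable (D : AffineConn n M)

theorem covD_add {k : ℕ} {S T : RawField n M k} (hS : IsTensorField S) (hT : IsTensorField T)
    (x : M) (v : Fin (k + 1) → TangentSpace (𝓡 n) x) :
    D.covD (fun y e => S y e + T y e) x v = D.covD S x v + D.covD T x v := by
  simp only [covD]
  rw [mvfderiv_fun_add (hS.mdiff_ext _) (hT.mdiff_ext _), Finset.sum_add_distrib]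
  simp only [add_apply]
  ring

theorem covD_smul {k : ℕ} {f : M → ℝ} {T : RawField n M k} (hf : SmoothFn n f)
    (hT : IsTensorField T) (x : M) (v : Fin (k + 1) → TangentSpace (𝓡 n) x) :
    D.covD (fun y e => f y * T y e) x v =
      mvfderiv (𝓡 n) f x (v 0) * T x (Fin.tail v) + f x * D.covD T x v := by
  simp only [covD]
  rw [mvfderiv_fun_mul ((hf x).mdifferentiableAt (by simp)) (hT.mdiff_ext _), ← Finset.mul_sum]
  simp
  ring

theorem covD_const_mul {k : ℕ} {T : RawField n M k} (c : ℝ)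
    (hT : IsTensorField T) (x : M) (v : Fin (k + 1) → TangentSpace (𝓡 n) x) :
    D.covD (fun y e => c * T y e) x v = c * D.covD T x v := by
  rw [D.covD_smul contMDiff_const hT, mvfderiv_const]
  simp

theorem covD_perm {k : ℕ} (T : RawField n M k) (ρ : Equiv.Perm (Fin k)) (x : M)
    (u : TangentSpace (𝓡 n) x) (v : Fin k → TangentSpace (𝓡 n) x) :
    D.covD (fun y e => T y (fun i => e (ρ i))) x (Fin.cons u v) =
      D.covD T x (Fin.cons u (fun i => v (ρ i))) := by
  simp only [covD, Fin.tail_cons, Fin.cons_zero]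
  congr 1
  rw [← Equiv.sum_comp ρ]
  refine Finset.sum_congr rfl fun i _ => ?_
  congr 1
  funext j
  by_cases h : j = i
  · subst h
    simp
  · simp [h]

theorem covD_tmul {k : ℕ} {S : RawField n M 1} {T : RawField n M k} (hS : IsTensorField S)
    (hT : IsTensorField T) (x : M) (u v : TangentSpace (𝓡 n) x)
    (e : Fin k → TangentSpace (𝓡 n) x) :
    D.covD (fun y e => S y ![e 0] * T y (Fin.tail e) : RawField n M (k + 1)) x
        (Fin.cons u (Fin.cons v e)) =
      D.covD S x ![u, v] * T x e + S x ![v] * D.covD T x (Fin.cons u e) := by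
  have h1 : ∀ y, (fun i => ext (![v] i) y) = ![ext v y] := fun y => by
    funext i
    fin_cases i
    rfl
  have hS1 : MDiffFn n (fun y => S y ![ext v y]) x := by
    simpa only [h1] using hS.mdiff_ext ![v]
  have e1 : D.covD S x ![u, v] = mvfderiv (𝓡 n) (fun y => S y ![ext v y]) x u
      - S x ![D.cov (ext v) x u] := by
    have h2 : ∀ y, (fun i => ext (Fin.tail ![u, v] i) y) = ![ext v y] := h1
    simp only [covD, h2]
    simp only [Finset.univ_unique, Finset.sum_singleton]
    congr 2
    funext i
    fin_cases i
    simp [Fin.tail]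
  rw [e1]
  simp only [covD, Fin.tail_cons, Fin.cons_zero, Fin.sum_univ_succ, Fin.cons_succ,
    Fin.update_cons_zero, ← Fin.cons_update]
  have h3 : ∀ y, (Fin.tail fun i => ext ((Fin.cons v e : Fin (k + 1) → TangentSpace (𝓡 n) x) i) y) =
      fun i => ext (e i) y := fun y => rfl
  simp only [h3, ← Finset.mul_sum]
  rw [mvfderiv_fun_mul hS1 (hT.mdiff_ext _)]
  simp
  ring

theorem covD_of_projChange {D' : AffineConn n M} {Y : RawField n M 1} (h : ProjChange D D' Y)
    {k : ℕ} {T : RawField n M k} (hT : IsTensorField T) (x : M)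
    (u : TangentSpace (𝓡 n) x) (v : Fin k → TangentSpace (𝓡 n) x) :
    D'.covD T x (Fin.cons u v) = D.covD T x (Fin.cons u v) - k * Y x ![u] * T x v
      - ∑ i, Y x ![v i] * T x (Function.update v i u) := by
  obtain ⟨f, hf⟩ := hT.multilinear x
  simp only [covD, Fin.tail_cons, Fin.cons_zero]
  have : ∀ i, D'.cov (ext (v i)) x u = D.cov (ext (v i)) x u + Y x ![u] • v i + Y x ![v i] • u :=
    fun i => by simpa using h x (ext (v i)) (mdiffAt_ext (v i)) u
  simp only [this, hf, MultilinearMap.map_update_add, MultilinearMap.map_update_smul,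
    Function.update_eq_self, Finset.sum_add_distrib, smul_eq_mul, Finset.sum_const,
    Finset.card_univ, Fintype.card_fin, nsmul_eq_mul]
  ring

end AffineConn

/-! ### Volume forms and the connection form `theta` on densities. -/

theorem exists_multilinear_one {T : RawField n M 1} {x : M}
    (hadd : ∀ a b : TangentSpace (𝓡 n) x, T x ![a + b] = T x ![a] + T x ![b])
    (hsmul : ∀ (c : ℝ) (a : TangentSpace (𝓡 n) x), T x ![c • a] = c * T x ![a]) :
    ∃ f : MultilinearMap ℝ (fun _ : Fin 1 => TangentSpace (𝓡 n) x) ℝ, ∀ v, T x v = f v := by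
  let L : TangentSpace (𝓡 n) x →ₗ[ℝ] ℝ :=
    { toFun := fun a => T x ![a], map_add' := hadd, map_smul' := hsmul }
  refine ⟨MultilinearMap.ofSubsingleton ℝ (TangentSpace (𝓡 n) x) ℝ (0 : Fin 1) L, fun v => ?_⟩
  change T x v = T x ![v 0]
  congr 1
  funext i
  fin_cases i
  rfl

theorem exists_multilinear_two {T : RawField n M 2} {x : M}
    (hadd : ∀ a b c : TangentSpace (𝓡 n) x, T x ![a + b, c] = T x ![a, c] + T x ![b, c])
    (hsmul : ∀ (r : ℝ) (a c : TangentSpace (𝓡 n) x), T x ![r • a, c] = r * T x ![a, c])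
    (hadd' : ∀ a b c : TangentSpace (𝓡 n) x, T x ![c, a + b] = T x ![c, a] + T x ![c, b])
    (hsmul' : ∀ (r : ℝ) (a c : TangentSpace (𝓡 n) x), T x ![c, r • a] = r * T x ![c, a]) :
    ∃ f : MultilinearMap ℝ (fun _ : Fin 2 => TangentSpace (𝓡 n) x) ℝ, ∀ v, T x v = f v := by
  let L : TangentSpace (𝓡 n) x →ₗ[ℝ] TangentSpace (𝓡 n) x →ₗ[ℝ] ℝ :=
    LinearMap.mk₂ ℝ (fun a b => T x ![a, b]) hadd hsmul (fun c a b => hadd' a b c)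
      (fun r c a => hsmul' r a c)
  refine ⟨LinearMap.uncurryLeft
    { toFun := fun a => MultilinearMap.ofSubsingleton ℝ (TangentSpace (𝓡 n) x) ℝ (0 : Fin 1) (L a)
      map_add' := fun a b => by ext; simp
      map_smul' := fun c a => by ext; simp }, fun v => ?_⟩
  change T x v = T x ![v 0, v 1]
  congr 1
  funext i
  fin_cases i <;> rfl

/-- `stdBasis` as a basis. -/
def tangentBasis (x : M) : Module.Basis (Fin n) ℝ (TangentSpace (𝓡 n) x) :=
  (EuclideanSpace.basisFun (Fin n) ℝ).toBasis

theorem tangentBasis_apply (x : M) (i : Fin n) : tangentBasis (n := n) x i = stdBasis x i := by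
  change (EuclideanSpace.basisFun (Fin n) ℝ).toBasis i = _
  simp [stdBasis]

theorem coe_tangentBasis (x : M) : ⇑(tangentBasis (n := n) x) = stdBasis x :=
  funext (tangentBasis_apply x)

theorem tangentBasis_repr {x : M} (v : TangentSpace (𝓡 n) x) (i : Fin n) :
    (tangentBasis x).repr v i = stdCoord v i := rfl

theorem sum_stdCoord {x : M} (v : TangentSpace (𝓡 n) x) : ∑ i, stdCoord v i • stdBasis x i = v := by
  simpa only [tangentBasis_repr, tangentBasis_apply] using (tangentBasis x).sum_repr v

theorem VolumeForm.isTensorField (vol : VolumeForm n M) :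
    IsTensorField (fun x v => vol.form x v : RawField n M n) := vol.smooth

theorem VolumeForm.eq_mul_det (vol : VolumeForm n M) (x : M) (v : Fin n → TangentSpace (𝓡 n) x) :
    vol.form x v = vol.form x (stdBasis x) * (tangentBasis x).det v := by
  conv_lhs => rw [(vol.form x).eq_smul_basis_det (tangentBasis x)]
  simp [coe_tangentBasis]

theorem VolumeForm.stdBasis_ne_zero (vol : VolumeForm n M) (x : M) :
    vol.form x (stdBasis x) ≠ 0 := fun h => vol.ne_zero x <| by
  ext v
  rw [vol.eq_mul_det, h]
  simp

/-- An endomorphism acts on a top-degree form as a derivation by its trace: in slot `i` only the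
`i`-th coordinate of `A i` survives alternation. -/
theorem VolumeForm.sum_update (vol : VolumeForm n M) (x : M)
    (A : Fin n → TangentSpace (𝓡 n) x) :
    ∑ i, vol.form x (Function.update (stdBasis x) i (A i)) =
      (∑ i, stdCoord (A i) i) * vol.form x (stdBasis x) := by
  rw [Finset.sum_mul]
  refine Finset.sum_congr rfl fun i _ => ?_
  conv_lhs => rw [← sum_stdCoord (A i), AlternatingMap.map_update_sum]
  simp only [AlternatingMap.map_update_smul, smul_eq_mul]
  rw [Finset.sum_eq_single i]
  · rw [Function.update_eq_self]
  · intro j _ hj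
    rw [AlternatingMap.map_update_self _ _ hj.symm, mul_zero]
  · simp

namespace AffineConn

variable (D : AffineConn n M)

theorem covD_vol_swap (vol : VolumeForm n M) (x : M) (u : TangentSpace (𝓡 n) x)
    (v : Fin n → TangentSpace (𝓡 n) x) {i j : Fin n} (hij : i ≠ j) :
    D.covD (fun y e => vol.form y e) x (Fin.cons u (fun l => v (Equiv.swap i j l))) =
      - D.covD (fun y e => vol.form y e) x (Fin.cons u v) := by
  rw [← D.covD_perm (fun y e => vol.form y e) (Equiv.swap i j)]
  have : (fun y e => vol.form y fun l => e (Equiv.swap i j l) : RawField n M n) =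
      fun y e => (-1 : ℝ) * vol.form y e := by
    funext y e
    have := (vol.form y).map_swap e hij
    simpa [Function.comp_def] using this
  rw [this, D.covD_const_mul (-1) vol.isTensorField]
  ring

/-- `∇_u ω` as an alternating map. -/
def covVol (vol : VolumeForm n M) (x : M) (u : TangentSpace (𝓡 n) x) :
    TangentSpace (𝓡 n) x [⋀^Fin n]→ₗ[ℝ] ℝ :=
  { ((D.isTensorField_covD vol.isTensorField).multilinear x).choose.curryLeft u with
    map_eq_zero_of_eq' := by
      intro v i j h hij
      have hf := ((D.isTensorField_covD vol.isTensorField).multilinear x).choose_spec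
      have h1 := D.covD_vol_swap vol x u v hij
      have h2 : (fun l => v (Equiv.swap i j l)) = v := by
        funext l
        rcases Equiv.swap_apply_eq_iff.1 (rfl : Equiv.swap i j l = _) with -
        by_cases hi : l = i
        · subst hi
          simp [h]
        · by_cases hj : l = j
          · subst hj
            simp [h]
          · rw [Equiv.swap_apply_of_ne_of_ne hi hj]
      rw [h2] at h1
      have h3 : D.covD (fun y e => vol.form y e) x (Fin.cons u v) = 0 := by linarith
      rw [hf] at h3
      exact h3 }

theorem covVol_apply (vol : VolumeForm n M) (x : M) (u : TangentSpace (𝓡 n) x)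
    (v : Fin n → TangentSpace (𝓡 n) x) :
    D.covVol vol x u v = D.covD (fun y e => vol.form y e) x (Fin.cons u v) :=
  (((D.isTensorField_covD vol.isTensorField).multilinear x).choose_spec _).symm

end AffineConn

namespace Gauge

variable {p : ProjectiveStructure n M} (g : Gauge p)

/-- `∇_u ω` is alternating of top degree, hence a multiple of `ω`, and `theta` is the ratio of the
two on one basis. -/
theorem covD_vol (x : M) (u : TangentSpace (𝓡 n) x) (v : Fin n → TangentSpace (𝓡 n) x) :
    g.conn.covD (fun y e => g.vol.form y e) x (Fin.cons u v) =
      g.theta x ![u] * g.vol.form x v := by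
  have h0 := g.vol.stdBasis_ne_zero x
  have h1 : g.theta x ![u] * g.vol.form x (stdBasis x) = g.conn.covVol g.vol x u (stdBasis x) := by
    simp only [theta, AffineConn.covVol_apply, Matrix.cons_val_zero]
    field_simp
  rw [← AffineConn.covVol_apply, (g.conn.covVol g.vol x u).eq_smul_basis_det (tangentBasis x),
    g.vol.eq_mul_det, ← mul_assoc, h1]
  simp [coe_tangentBasis]

/-- `stdBasis` comes from the preferred chart at each point and need not vary continuously.
Smoothness near `x` is therefore read off from the same ratio on smooth extensions of the basis at
`x`. -/
theorem isTensorField_theta : IsTensorField g.theta := by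
  have hT := g.conn.isTensorField_covD g.vol.isTensorField
  refine isTensorField_of_smoothVF (fun x => ?_) fun V hV x => ?_
  · obtain ⟨f, hf⟩ := hT.multilinear x
    refine exists_multilinear_one (fun a b => ?_) (fun c a => ?_)
    · simp [theta, hf, f.cons_add, add_div]
    · simp [theta, hf, f.cons_smul, mul_div_assoc]
  · have hE : ∀ i, SmoothVF (gext (stdBasis (n := n) x i)) := fun i => smoothVF_gext _
    have h1 : SmoothFn n (fun y => g.vol.form y (fun i => gext (stdBasis (n := n) x i) y)) :=
      g.vol.isTensorField.smoothFn hE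
    have h2 : g.vol.form x (fun i => gext (stdBasis (n := n) x i) x) ≠ 0 := by
      simpa using g.vol.stdBasis_ne_zero x
    have h3 : ∀ᶠ y in 𝓝 x, g.vol.form y (fun i => gext (stdBasis (n := n) x i) y) ≠ 0 :=
      h1.continuous.continuousAt.eventually_ne h2
    have h4 : SmoothFn n (fun y => g.conn.covD (fun y e => g.vol.form y e) y
        (Fin.cons (V 0 y) fun i => gext (stdBasis (n := n) x i) y)) := by
      have := hT.smoothFn (V := Fin.cons (V 0) fun i => gext (stdBasis (n := n) x i))
        (Fin.cases (hV 0) hE)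
      convert this using 2 with y
      congr 1
      funext i
      refine Fin.cases ?_ (fun i => ?_) i <;> simp
    refine ((h4 x).div₀ (h1 x) h2).congr_of_eventuallyEq ?_
    filter_upwards [h3] with y hy
    rw [Pi.div_apply, covD_vol, mul_div_assoc, div_self hy, mul_one]
    congr 1
    funext i
    fin_cases i
    rfl

/-- This is the Ricci identity for the volume form: since `∇ω = θ ⊗ ω`, the products of two `θ`
cancel on skewing, and curvature acts on `ω` by minus its trace. -/
theorem covD_theta_sub (x : M) (u v : TangentSpace (𝓡 n) x) :
    g.conn.covD g.theta x ![u, v] - g.conn.covD g.theta x ![v, u] =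
      - ∑ i, stdCoord (g.conn.curv x u v (stdBasis x i)) i := by
  have h0 := g.vol.stdBasis_ne_zero x
  have h1 := g.conn.covD_covD_sub g.vol.isTensorField x u v (stdBasis x)
  have h2 : g.conn.covD (fun y e => g.vol.form y e) =
      fun y e => g.theta y ![e 0] * g.vol.form y (Fin.tail e) := by
    funext y e
    conv_lhs => rw [← Fin.cons_self_tail e]
    exact g.covD_vol y (e 0) (Fin.tail e)
  rw [h2, g.conn.covD_tmul g.isTensorField_theta g.vol.isTensorField,
    g.conn.covD_tmul g.isTensorField_theta g.vol.isTensorField, covD_vol, covD_vol,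
    g.vol.sum_update] at h1
  refine mul_right_cancel₀ h0 ?_
  linarith

end Gauge

/-! ### The Bianchi identity and the traces of the curvature. -/

namespace AffineConn

variable (D : AffineConn n M)

theorem curv_swap (x : M) (u v w : TangentSpace (𝓡 n) x) : D.curv x u v w = - D.curv x v u w := by
  simp only [curv]
  rw [VectorField.mlieBracket_swap_apply, map_neg]
  abel

/-- The first Bianchi identity. -/
theorem curv_cyclic (x : M) (u v w : TangentSpace (𝓡 n) x) :
    D.curv x u v w + D.curv x v w u + D.curv x w u v = 0 := by
  have hu := smoothVF_gext u
  have hv := smoothVF_gext v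
  have hw := smoothVF_gext w
  have J := mlieBracket_jacobi hu hv hw x
  have hb : ∀ {U V : (y : M) → TangentSpace (𝓡 n) y}, SmoothVF U → SmoothVF V →
      VectorField.mlieBracket (𝓡 n) U V = (fun y => D.cov V y (U y)) - fun y => D.cov U y (V y) :=
    fun hU hV => funext fun y => D.mlieBracket_eq (hU.mdiff y) (hV.mdiff y)
  have hsub : ∀ {U V : (y : M) → TangentSpace (𝓡 n) y}, SmoothVF U → SmoothVF V →
      D.cov (U - V) x = D.cov U x - D.cov V x := fun {U V} hU hV => by
    rw [eq_sub_iff_add_eq, ← D.cov.isCovariantDerivativeOnUniv.add ((hU.sub hV).mdiff x)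
      (hV.mdiff x), sub_add_cancel]
  have huv := smoothVF_mlieBracket hu hv
  have huw := smoothVF_mlieBracket hu hw
  have hvw := smoothVF_mlieBracket hv hw
  -- Vanishing torsion turns all brackets in the Jacobi identity into covariant derivatives, and the
  -- result regroups into three curvatures.
  rw [D.mlieBracket_eq (hu.mdiff x) (hvw.mdiff x), D.mlieBracket_eq (huv.mdiff x) (hw.mdiff x),
    D.mlieBracket_eq (hv.mdiff x) (huw.mdiff x)] at J
  have e1 : D.cov (VectorField.mlieBracket (𝓡 n) (gext v) (gext w)) x =
      D.cov (fun y => D.cov (gext w) y (gext v y)) x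
        - D.cov (fun y => D.cov (gext v) y (gext w y)) x := by
    rw [hb hv hw, hsub (D.smoothVF_cov hv hw) (D.smoothVF_cov hw hv)]
  have e2 : D.cov (VectorField.mlieBracket (𝓡 n) (gext u) (gext w)) x =
      D.cov (fun y => D.cov (gext w) y (gext u y)) x
        - D.cov (fun y => D.cov (gext u) y (gext w y)) x := by
    rw [hb hu hw, hsub (D.smoothVF_cov hu hw) (D.smoothVF_cov hw hu)]
  have e3 : D.cov (VectorField.mlieBracket (𝓡 n) (gext u) (gext v)) x =
      D.cov (fun y => D.cov (gext v) y (gext u y)) x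
        - D.cov (fun y => D.cov (gext u) y (gext v y)) x := by
    rw [hb hu hv, hsub (D.smoothVF_cov hu hv) (D.smoothVF_cov hv hu)]
  rw [e1, e2, e3] at J
  simp only [curv_eq_curvOn, curvOn, gext_self, sub_apply] at J ⊢
  rw [VectorField.mlieBracket_swap_apply (V := gext w) (W := gext u), map_neg]
  rw [← sub_eq_zero] at J
  rw [← J]
  abel

theorem sum_stdCoord_curv (x : M) (u v : TangentSpace (𝓡 n) x) :
    ∑ i, stdCoord (D.curv x u v (stdBasis x i)) i = D.ric x ![v, u] - D.ric x ![u, v] := by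
  have h : ∀ i, stdCoord (D.curv x u v (stdBasis x i)) i =
      stdCoord (D.curv x (stdBasis x i) v u) i - stdCoord (D.curv x (stdBasis x i) u v) i := by
    intro i
    have h1 := D.curv_cyclic x u v (stdBasis x i)
    rw [D.curv_swap x v (stdBasis x i) u] at h1
    have h2 : D.curv x u v (stdBasis x i) =
        D.curv x (stdBasis x i) v u - D.curv x (stdBasis x i) u v := by
      rw [← sub_eq_zero, ← h1]
      abel
    simp only [← tangentBasis_repr, h2, map_sub, Finsupp.sub_apply]
  simp only [h, Finset.sum_sub_distrib, ric, Matrix.cons_val_zero, Matrix.cons_val_one]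

/-- The skew part of `schouten` carries the factor $(n-1)/(n^2-1)=1/(n+1)$. The bound on `n` keeps
the denominator nonzero. -/
theorem schouten_sub_swap (hn : 2 ≤ n) (x : M) (u v : TangentSpace (𝓡 n) x) :
    ((n : ℝ) + 1) * (D.schouten x ![u, v] - D.schouten x ![v, u]) =
      D.ric x ![u, v] - D.ric x ![v, u] := by
  have h2 : (2 : ℝ) ≤ n := by exact_mod_cast hn
  have h : (n : ℝ) ^ 2 - 1 ≠ 0 := by nlinarith
  simp only [schouten, Matrix.cons_val_zero, Matrix.cons_val_one]
  field_simp
  ring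

end AffineConn

/-! ### Linearity in single slots; the Ricci and Schouten tensors are tensor fields. -/

namespace IsTensorField

theorem map_add₁ {T : RawField n M 1} (hT : IsTensorField T) (x : M)
    (a b : TangentSpace (𝓡 n) x) : T x ![a + b] = T x ![a] + T x ![b] := by
  obtain ⟨f, hf⟩ := hT.multilinear x
  simpa only [hf] using! f.cons_add ![] a b

theorem map_smul₁ {T : RawField n M 1} (hT : IsTensorField T) (x : M) (c : ℝ)
    (a : TangentSpace (𝓡 n) x) : T x ![c • a] = c * T x ![a] := by
  obtain ⟨f, hf⟩ := hT.multilinear x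
  simpa only [hf] using! f.cons_smul ![] c a

/-- The linear functional given by a one-form at a point. -/
def toLinearMap {T : RawField n M 1} (hT : IsTensorField T) (x : M) :
    TangentSpace (𝓡 n) x →ₗ[ℝ] ℝ where
  toFun a := T x ![a]
  map_add' := hT.map_add₁ x
  map_smul' := hT.map_smul₁ x

theorem toLinearMap_apply {T : RawField n M 1} (hT : IsTensorField T) (x : M)
    (a : TangentSpace (𝓡 n) x) : hT.toLinearMap x a = T x ![a] := rfl

theorem map_update_add {k : ℕ} {T : RawField n M k} (hT : IsTensorField T) (x : M)
    (v : Fin k → TangentSpace (𝓡 n) x) (i : Fin k) (a b : TangentSpace (𝓡 n) x) :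
    T x (Function.update v i (a + b)) =
      T x (Function.update v i a) + T x (Function.update v i b) := by
  obtain ⟨f, hf⟩ := hT.multilinear x
  simp only [hf, f.map_update_add]

theorem map_update_smul {k : ℕ} {T : RawField n M k} (hT : IsTensorField T) (x : M)
    (v : Fin k → TangentSpace (𝓡 n) x) (i : Fin k) (c : ℝ) (a : TangentSpace (𝓡 n) x) :
    T x (Function.update v i (c • a)) = c * T x (Function.update v i a) := by
  obtain ⟨f, hf⟩ := hT.multilinear x
  simp only [hf, f.map_update_smul, smul_eq_mul]

theorem map_add₂_fst {T : RawField n M 2} (hT : IsTensorField T) (x : M)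
    (a b v : TangentSpace (𝓡 n) x) :
    T x ![a + b, v] = T x ![a, v] + T x ![b, v] := by
  have h := hT.map_update_add x ![0, v] 0 a b
  have e : ∀ c, Function.update ![0, v] 0 c = ![c, v] := fun c => by
    funext i
    fin_cases i <;> rfl
  rwa [e, e, e] at h

theorem map_smul₂_fst {T : RawField n M 2} (hT : IsTensorField T) (x : M) (c : ℝ)
    (a v : TangentSpace (𝓡 n) x) :
    T x ![c • a, v] = c * T x ![a, v] := by
  have h := hT.map_update_smul x ![0, v] 0 c a
  have e : ∀ c, Function.update ![0, v] 0 c = ![c, v] := fun c => by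
    funext i
    fin_cases i <;> rfl
  rwa [e, e] at h

theorem map_add₂_snd {T : RawField n M 2} (hT : IsTensorField T) (x : M)
    (a b u : TangentSpace (𝓡 n) x) :
    T x ![u, a + b] = T x ![u, a] + T x ![u, b] := by
  have h := hT.map_update_add x ![u, 0] 1 a b
  have e : ∀ c, Function.update ![u, 0] 1 c = ![u, c] := fun c => by
    funext i
    fin_cases i <;> rfl
  rwa [e, e, e] at h

theorem map_smul₂_snd {T : RawField n M 2} (hT : IsTensorField T) (x : M) (c : ℝ)
    (a u : TangentSpace (𝓡 n) x) :
    T x ![u, c • a] = c * T x ![u, a] := by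
  have h := hT.map_update_smul x ![u, 0] 1 c a
  have e : ∀ c, Function.update ![u, 0] 1 c = ![u, c] := fun c => by
    funext i
    fin_cases i <;> rfl
  rwa [e, e] at h

theorem map_add₃_fst {T : RawField n M 3} (hT : IsTensorField T) (x : M)
    (a b v w : TangentSpace (𝓡 n) x) :
    T x ![a + b, v, w] = T x ![a, v, w] + T x ![b, v, w] := by
  have h := hT.map_update_add x ![0, v, w] 0 a b
  have e : ∀ c, Function.update ![0, v, w] 0 c = ![c, v, w] := fun c => by
    funext i
    fin_cases i <;> rfl
  rwa [e, e, e] at h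

theorem map_smul₃_fst {T : RawField n M 3} (hT : IsTensorField T) (x : M) (c : ℝ)
    (a v w : TangentSpace (𝓡 n) x) :
    T x ![c • a, v, w] = c * T x ![a, v, w] := by
  have h := hT.map_update_smul x ![0, v, w] 0 c a
  have e : ∀ c, Function.update ![0, v, w] 0 c = ![c, v, w] := fun c => by
    funext i
    fin_cases i <;> rfl
  rwa [e, e] at h

theorem map_add₃_snd {T : RawField n M 3} (hT : IsTensorField T) (x : M)
    (a b u w : TangentSpace (𝓡 n) x) :
    T x ![u, a + b, w] = T x ![u, a, w] + T x ![u, b, w] := by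
  have h := hT.map_update_add x ![u, 0, w] 1 a b
  have e : ∀ c, Function.update ![u, 0, w] 1 c = ![u, c, w] := fun c => by
    funext i
    fin_cases i <;> rfl
  rwa [e, e, e] at h

theorem map_smul₃_snd {T : RawField n M 3} (hT : IsTensorField T) (x : M) (c : ℝ)
    (a u w : TangentSpace (𝓡 n) x) :
    T x ![u, c • a, w] = c * T x ![u, a, w] := by
  have h := hT.map_update_smul x ![u, 0, w] 1 c a
  have e : ∀ c, Function.update ![u, 0, w] 1 c = ![u, c, w] := fun c => by
    funext i
    fin_cases i <;> rfl
  rwa [e, e] at h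

theorem map_add₃_trd {T : RawField n M 3} (hT : IsTensorField T) (x : M)
    (a b u v : TangentSpace (𝓡 n) x) :
    T x ![u, v, a + b] = T x ![u, v, a] + T x ![u, v, b] := by
  have h := hT.map_update_add x ![u, v, 0] 2 a b
  have e : ∀ c, Function.update ![u, v, 0] 2 c = ![u, v, c] := fun c => by
    funext i
    fin_cases i <;> rfl
  rwa [e, e, e] at h

theorem map_smul₃_trd {T : RawField n M 3} (hT : IsTensorField T) (x : M) (c : ℝ)
    (a u v : TangentSpace (𝓡 n) x) :
    T x ![u, v, c • a] = c * T x ![u, v, a] := by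
  have h := hT.map_update_smul x ![u, v, 0] 2 c a
  have e : ∀ c, Function.update ![u, v, 0] 2 c = ![u, v, c] := fun c => by
    funext i
    fin_cases i <;> rfl
  rwa [e, e] at h

end IsTensorField

theorem IsTensorField.smoothFn₃ {T : RawField n M 3} (hT : IsTensorField T)
    {U V W : (y : M) → TangentSpace (𝓡 n) y} (hU : SmoothVF U) (hV : SmoothVF V)
    (hW : SmoothVF W) : SmoothFn n (fun y => T y ![U y, V y, W y]) := by
  have h := hT.smoothFn (V := ![U, V, W]) (fun i => by fin_cases i <;> assumption)
  convert h using 2 with y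
  congr 1
  funext i
  fin_cases i <;> rfl

/-- A coframe of one-forms near `x`. -/
theorem exists_coframe (x : M) : ∃ (E : Fin n → (y : M) → TangentSpace (𝓡 n) y)
    (μ : Fin n → RawField n M 1), (∀ i, SmoothVF (E i)) ∧ (∀ i, IsTensorField (μ i)) ∧
    (∀ᶠ y in 𝓝 x, ∀ v : TangentSpace (𝓡 n) y, v = ∑ i, μ i y ![v] • E i y) := by
  obtain ⟨E, κ, hE, hsum, -, -, -, hκ⟩ := exists_frame (n := n) x
  refine ⟨E, fun i y e => κ i y (e 0), hE, fun i => isTensorField_of_smoothVF (fun y => ?_)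
    fun V hV => hκ i _ (hV 0), hsum⟩
  exact exists_multilinear_one (T := fun y e => κ i y (e 0)) (fun a b => (κ i y).map_add a b)
    (fun a b => (κ i y).map_smul a b)

namespace AffineConn

variable (D : AffineConn n M)

/-- The Ricci identity on one-forms writes each component of the curvature through `∇∇μ`, already
known to be a tensor field. Linearity of `curv` and smoothness of `ric` are drawn from this. -/
theorem oneForm_curv {μ : RawField n M 1} (hμ : IsTensorField μ) (x : M)
    (u v w : TangentSpace (𝓡 n) x) : μ x ![D.curv x u v w] =
      D.covD (D.covD μ) x ![v, u, w] - D.covD (D.covD μ) x ![u, v, w] := by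
  have h := D.covD_covD_sub hμ x u v ![w]
  simp only [Finset.univ_unique, Finset.sum_singleton] at h
  have e : Function.update ![w] default (D.curv x u v (![w] default)) = ![D.curv x u v w] := by
    funext i
    fin_cases i
    rfl
  rw [e] at h
  have e1 : ∀ a b : TangentSpace (𝓡 n) x, (Fin.cons a (Fin.cons b ![w]) : Fin 3 → _) = ![a, b, w] :=
    fun a b => rfl
  rw [e1, e1] at h
  linarith

theorem curv_add_left (x : M) (a b v w : TangentSpace (𝓡 n) x) :
    D.curv x (a + b) v w = D.curv x a v w + D.curv x b v w := by
  obtain ⟨E, μ, -, hμ, h⟩ := exists_coframe (n := n) x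
  have h' := h.self_of_nhds
  rw [h' (D.curv x (a + b) v w), h' (D.curv x a v w), h' (D.curv x b v w),
    ← Finset.sum_add_distrib]
  refine Finset.sum_congr rfl fun i _ => ?_
  have hT := D.isTensorField_covD (D.isTensorField_covD (hμ i))
  rw [← add_smul, D.oneForm_curv (hμ i), D.oneForm_curv (hμ i), D.oneForm_curv (hμ i),
    hT.map_add₃_fst, hT.map_add₃_snd]
  congr 1
  ring

theorem curv_smul_left (x : M) (c : ℝ) (a v w : TangentSpace (𝓡 n) x) :
    D.curv x (c • a) v w = c • D.curv x a v w := by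
  obtain ⟨E, μ, -, hμ, h⟩ := exists_coframe (n := n) x
  have h' := h.self_of_nhds
  rw [h' (D.curv x (c • a) v w), h' (D.curv x a v w), Finset.smul_sum]
  refine Finset.sum_congr rfl fun i _ => ?_
  have hT := D.isTensorField_covD (D.isTensorField_covD (hμ i))
  rw [smul_smul, D.oneForm_curv (hμ i), D.oneForm_curv (hμ i), hT.map_smul₃_fst,
    hT.map_smul₃_snd]
  congr 1
  ring

/-- The trace does not depend on the basis, so the Ricci tensor can be computed in a smooth frame
instead of `stdBasis`. -/
theorem sum_stdCoord_eq {x : M} (L : TangentSpace (𝓡 n) x →ₗ[ℝ] TangentSpace (𝓡 n) x)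
    (E : Fin n → TangentSpace (𝓡 n) x) (κ : Fin n → TangentSpace (𝓡 n) x →ₗ[ℝ] ℝ)
    (h : ∀ v, v = ∑ i, κ i v • E i) :
    ∑ j, stdCoord (L (stdBasis x j)) j = ∑ i, κ i (L (E i)) := by
  have h1 : ∀ j, stdCoord (L (stdBasis x j)) j =
      ∑ i, κ i (stdBasis x j) * stdCoord (L (E i)) j := fun j => by
    conv_lhs => rw [h (stdBasis x j)]
    simp only [map_sum, map_smul, ← tangentBasis_repr, Finsupp.coe_finsetSum, Finset.sum_apply,
      Finsupp.smul_apply, smul_eq_mul]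
  have h2 : ∀ i, κ i (L (E i)) = ∑ j, κ i (stdBasis x j) * stdCoord (L (E i)) j := fun i => by
    conv_lhs => rw [← sum_stdCoord (L (E i))]
    simp only [map_sum, map_smul, smul_eq_mul]
    exact Finset.sum_congr rfl fun j _ => mul_comm _ _
  simp only [h1, h2]
  exact Finset.sum_comm

theorem sum_stdCoord_mul {x : M} (L : TangentSpace (𝓡 n) x →ₗ[ℝ] ℝ) (a : TangentSpace (𝓡 n) x) :
    ∑ i, L (stdBasis x i) * stdCoord a i = L a := by
  conv_rhs => rw [← sum_stdCoord a]
  simp [mul_comm]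

theorem ric_eventuallyEq (x : M) : ∃ (E : Fin n → (y : M) → TangentSpace (𝓡 n) y)
    (μ : Fin n → RawField n M 1), (∀ i, SmoothVF (E i)) ∧ (∀ i, IsTensorField (μ i)) ∧
    (∀ᶠ y in 𝓝 x, ∀ a b : TangentSpace (𝓡 n) y, D.ric y ![a, b] =
      ∑ i, (D.covD (D.covD (μ i)) y ![a, E i y, b] - D.covD (D.covD (μ i)) y ![E i y, a, b])) := by
  obtain ⟨E, μ, hE, hμ, h⟩ := exists_coframe (n := n) x
  refine ⟨E, μ, hE, hμ, h.mono fun y hy a b => ?_⟩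
  let L : TangentSpace (𝓡 n) y →ₗ[ℝ] TangentSpace (𝓡 n) y :=
    { toFun := fun u => D.curv y u a b
      map_add' := fun u v => D.curv_add_left y u v a b
      map_smul' := fun c u => D.curv_smul_left y c u a b }
  have := sum_stdCoord_eq L (fun i => E i y) (fun i => (hμ i).toLinearMap y) hy
  simp only [IsTensorField.toLinearMap_apply] at this
  change ∑ i, stdCoord (L (stdBasis y i)) i = _
  rw [this]
  exact Finset.sum_congr rfl fun i _ => D.oneForm_curv (hμ i) y (E i y) a b

theorem isTensorField_ric : IsTensorField D.ric := by
  refine isTensorField_of_smoothVF (fun x => ?_) fun V hV x => ?_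
  · obtain ⟨E, μ, hE, hμ, h⟩ := D.ric_eventuallyEq x
    have h' := h.self_of_nhds
    have hT := fun i => D.isTensorField_covD (D.isTensorField_covD (hμ i))
    refine exists_multilinear_two ?_ ?_ ?_ ?_ <;> intro _ _ _ <;>
      simp only [h', ← Finset.sum_add_distrib, Finset.mul_sum, fun i => (hT i).map_add₃_fst,
        fun i => (hT i).map_add₃_snd, fun i => (hT i).map_add₃_trd, fun i => (hT i).map_smul₃_fst,
        fun i => (hT i).map_smul₃_snd, fun i => (hT i).map_smul₃_trd] <;>
      refine Finset.sum_congr rfl fun i _ => ?_ <;> ring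
  · obtain ⟨E, μ, hE, hμ, h⟩ := D.ric_eventuallyEq x
    have hT := fun i => D.isTensorField_covD (D.isTensorField_covD (hμ i))
    have key : SmoothFn n (fun y => ∑ i, (D.covD (D.covD (μ i)) y ![V 0 y, E i y, V 1 y]
        - D.covD (D.covD (μ i)) y ![E i y, V 0 y, V 1 y])) :=
      ContMDiff.sum fun i _ => ((hT i).smoothFn₃ (hV 0) (hE i) (hV 1)).sub
        ((hT i).smoothFn₃ (hE i) (hV 0) (hV 1))
    refine (key x).congr_of_eventuallyEq (h.mono fun y hy => ?_)
    have e : (fun i => V i y) = ![V 0 y, V 1 y] := by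
      funext i
      fin_cases i <;> rfl
    exact (congrArg (D.ric y) e).trans (hy _ _)

theorem isTensorField_schouten : IsTensorField D.schouten := by
  have h := ((D.isTensorField_ric.const_mul n).add
    (D.isTensorField_ric.perm (Equiv.swap 0 1))).const_mul ((n : ℝ) ^ 2 - 1)⁻¹
  convert h using 1
  funext x v
  have e1 : (![v 0, v 1] : Fin 2 → TangentSpace (𝓡 n) x) = v := by
    funext i
    fin_cases i <;> rfl
  have e2 : (![v 1, v 0] : Fin 2 → TangentSpace (𝓡 n) x) = fun i => v (Equiv.swap 0 1 i) := by
    funext i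
    fin_cases i <;> rfl
  simp only [schouten]
  rw [e1, e2]
  ring

/-! ### Projective change of the curvature, Ricci and Schouten tensors. -/

theorem covD_one {Y : RawField n M 1} (hY : IsTensorField Y) (x : M) (u : TangentSpace (𝓡 n) x)
    {V : (y : M) → TangentSpace (𝓡 n) y} (hV : SmoothVF V) :
    mvfderiv (𝓡 n) (fun y => Y y ![V y]) x u = D.covD Y x ![u, V x] + Y x ![D.cov V x u] := by
  have e1 : ∀ y, (fun i : Fin 1 => (![V] : Fin 1 → (y : M) → TangentSpace (𝓡 n) y) i y) = ![V y] :=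
    fun y => by
      funext i
      fin_cases i
      rfl
  have h := D.covD_eq_covOn hY u (V := ![V]) (fun i => by fin_cases i; exact hV.at x)
  simp only [covOn, e1, Finset.univ_unique, Finset.sum_singleton] at h
  have e2 : Function.update ![V x] default (D.cov ((![V] : Fin 1 → (y : M) → TangentSpace (𝓡 n) y)
      default) x u) = ![D.cov V x u] := by
    funext i
    fin_cases i
    rfl
  rw [e2] at h
  have e3 : (Fin.cons u ![V x] : Fin 2 → TangentSpace (𝓡 n) x) = ![u, V x] := rfl
  rw [e3] at h
  linarith

theorem smoothFn_one {Y : RawField n M 1} (hY : IsTensorField Y)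
    {V : (y : M) → TangentSpace (𝓡 n) y} (hV : SmoothVF V) : SmoothFn n (fun y => Y y ![V y]) := by
  have h := hY.smoothFn (V := ![V]) (fun i => by fin_cases i; exact hV)
  convert h using 2 with y
  congr 1
  funext i
  fin_cases i
  rfl

theorem curv_of_projChange {D' : AffineConn n M} {Y : RawField n M 1} (hY : IsTensorField Y)
    (h : ProjChange D D' Y) (x : M) (u v w : TangentSpace (𝓡 n) x) :
    D'.curv x u v w = D.curv x u v w
      + ((D.covD Y x ![u, v] - Y x ![u] * Y x ![v])
        - (D.covD Y x ![v, u] - Y x ![v] * Y x ![u])) • w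
      + (D.covD Y x ![u, w] - Y x ![u] * Y x ![w]) • v
      - (D.covD Y x ![v, w] - Y x ![v] * Y x ![w]) • u := by
  -- After skewing in `a` and `b`, the first derivatives of the extensions cancel against the
  -- bracket term, and only `∇Y - Y ⊗ Y` remains.
  have key : ∀ a b : TangentSpace (𝓡 n) x,
      D'.cov (fun y => D'.cov (gext w) y (gext b y)) x a =
        D.cov (fun y => D.cov (gext w) y (gext b y)) x a
        + (Y x ![b] • D.cov (gext w) x a + (D.covD Y x ![a, b] + Y x ![D.cov (gext b) x a]) • w)
        + (Y x ![w] • D.cov (gext b) x a + (D.covD Y x ![a, w] + Y x ![D.cov (gext w) x a]) • b)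
        + Y x ![a] • (D.cov (gext w) x b + Y x ![b] • w + Y x ![w] • b)
        + (Y x ![D.cov (gext w) x b] + Y x ![b] * Y x ![w] + Y x ![w] * Y x ![b]) • a := by
    intro a b
    have hb := smoothVF_gext b
    have hw := smoothVF_gext w
    have e : (fun y => D'.cov (gext w) y (gext b y)) = (fun y => D.cov (gext w) y (gext b y))
        + (fun y => Y y ![gext b y]) • gext w + (fun y => Y y ![gext w y]) • gext b :=
      funext fun y => h y (gext w) (hw.mdiff y) (gext b y)
    have s1 := D.smoothVF_cov hb hw
    have f2 := smoothFn_one hY hb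
    have f3 := smoothFn_one hY hw
    have s2 := SmoothVF.smul f2 hw
    have s3 := SmoothVF.smul f3 hb
    rw [e, h x _ (((s1.add s2).add s3).mdiff x) a,
      D.cov.isCovariantDerivativeOnUniv.add ((s1.add s2).mdiff x) (s3.mdiff x),
      D.cov.isCovariantDerivativeOnUniv.add (s1.mdiff x) (s2.mdiff x),
      D.cov.isCovariantDerivativeOnUniv.leibniz (hw.mdiff x) ((f2 x).mdifferentiableAt (by simp)),
      D.cov.isCovariantDerivativeOnUniv.leibniz (hb.mdiff x) ((f3 x).mdifferentiableAt (by simp))]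
    simp only [add_apply, smul_apply, ContinuousLinearMap.smulRight_apply,
      Pi.add_apply, Pi.smul_apply', gext_self, D.covD_one hY x a hb, D.covD_one hY x a hw,
      hY.map_add₁, hY.map_smul₁]
  have hbr := D.mlieBracket_eq ((smoothVF_gext u).mdiff x) ((smoothVF_gext v).mdiff x)
  rw [curv_eq_curvOn, curv_eq_curvOn, curvOn, curvOn]
  simp only [gext_self] at hbr ⊢
  rw [key, key, h x _ ((smoothVF_gext w).mdiff x), hbr]
  have e4 : Y x ![D.cov (gext v) x u - D.cov (gext u) x v] =
      Y x ![D.cov (gext v) x u] - Y x ![D.cov (gext u) x v] := by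
    simpa only [hY.toLinearMap_apply] using (hY.toLinearMap x).map_sub _ _
  rw [e4, gext_self]
  simp only [map_sub]
  module

/-- With `P = ∇Y - Y ⊗ Y`, each term of `curv_of_projChange` is contracted; the factor `n` is the
trace of the identity. -/
theorem ric_of_projChange {D' : AffineConn n M} {Y : RawField n M 1} (hY : IsTensorField Y)
    (h : ProjChange D D' Y) (x : M) (v w : TangentSpace (𝓡 n) x) :
    D'.ric x ![v, w] = D.ric x ![v, w]
      + (D.covD Y x ![w, v] - Y x ![w] * Y x ![v])
      - n * (D.covD Y x ![v, w] - Y x ![v] * Y x ![w]) := by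
  have hP := (D.isTensorField_covD hY).sub (hY.tmul hY)
  set P : RawField n M 2 := fun x v => D.covD Y x v - Y x ![v 0] * Y x (Fin.tail v) with hPdef
  have e : ∀ a b : TangentSpace (𝓡 n) x, D.covD Y x ![a, b] - Y x ![a] * Y x ![b] = P x ![a, b] :=
    fun a b => rfl
  have h1 : ∀ a b : TangentSpace (𝓡 n) x,
      ∑ i, P x ![stdBasis x i, b] * stdCoord a i = P x ![a, b] :=
    fun a b => by
      let L : TangentSpace (𝓡 n) x →ₗ[ℝ] ℝ :=
        { toFun := fun a => P x ![a, b]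
          map_add' := fun a c => hP.map_add₂_fst x a c b
          map_smul' := fun r a => hP.map_smul₂_fst x r a b }
      exact sum_stdCoord_mul L a
  have h2 : ∀ a b : TangentSpace (𝓡 n) x,
      ∑ i, P x ![b, stdBasis x i] * stdCoord a i = P x ![b, a] :=
    fun a b => by
      let L : TangentSpace (𝓡 n) x →ₗ[ℝ] ℝ :=
        { toFun := fun a => P x ![b, a]
          map_add' := fun a c => hP.map_add₂_snd x a c b
          map_smul' := fun r a => hP.map_smul₂_snd x r a b }
      exact sum_stdCoord_mul L a
  have h3 : ∑ i : Fin n, stdCoord (stdBasis x i) i = n := by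
    simp [stdCoord, stdBasis]
  simp only [ric, Matrix.cons_val_zero, Matrix.cons_val_one, D.curv_of_projChange hY h, e,
    ← tangentBasis_repr, map_add, map_sub, map_smul, Finsupp.add_apply, Finsupp.sub_apply,
    Finsupp.smul_apply, smul_eq_mul, Finset.sum_add_distrib, Finset.sum_sub_distrib, sub_mul]
  simp only [tangentBasis_repr, ← Finset.mul_sum, h1, h2, h3]
  ring

theorem schouten_of_projChange (hn : 2 ≤ n) {D' : AffineConn n M} {Y : RawField n M 1}
    (hY : IsTensorField Y) (h : ProjChange D D' Y) (x : M) (v w : TangentSpace (𝓡 n) x) :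
    D'.schouten x ![v, w] = D.schouten x ![v, w] - D.covD Y x ![v, w] + Y x ![v] * Y x ![w] := by
  have h2 : (2 : ℝ) ≤ n := by exact_mod_cast hn
  have h0 : (n : ℝ) ^ 2 - 1 ≠ 0 := by nlinarith
  simp only [schouten, Matrix.cons_val_zero, Matrix.cons_val_one, D.ric_of_projChange hY h]
  field_simp
  ring

end AffineConn

/-! ### Weighted covariant derivatives and change of gauge. -/

theorem eq_vecEmpty {α : Type*} (v : Fin 0 → α) : v = ![] := Subsingleton.elim _ _

theorem cons_vecCons {α : Type*} {k : ℕ} (u : α) (v : Fin k → α) :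
    Matrix.vecCons u v = Fin.cons u v := rfl

theorem AffineConn.covD_zero (D : AffineConn n M) (τ : RawField n M 0) (x : M)
    (u : TangentSpace (𝓡 n) x) : D.covD τ x ![u] = mvfderiv (𝓡 n) (fun y => τ y ![]) x u := by
  have h : ∀ (y : M) (v : Fin 0 → TangentSpace (𝓡 n) y), τ y v = τ y ![] := fun y v => by
    rw [eq_vecEmpty v]
  simp [AffineConn.covD, h]

namespace Gauge

variable {p : ProjectiveStructure n M} (g : Gauge p)

theorem nabla_cons (w : ℝ) {k : ℕ} (T : RawField n M k) (x : M) (u : TangentSpace (𝓡 n) x)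
    (v : Fin k → TangentSpace (𝓡 n) x) : g.nabla w T x (Fin.cons u v) =
      g.conn.covD T x (Fin.cons u v) - w / ((n : ℝ) + 1) * g.theta x ![u] * T x v := rfl

theorem isTensorField_nabla (w : ℝ) {k : ℕ} {T : RawField n M k} (hT : IsTensorField T) :
    IsTensorField (g.nabla w T) := by
  have := (g.conn.isTensorField_covD hT).sub
    ((g.isTensorField_theta.tmul hT).const_mul (w / ((n : ℝ) + 1)))
  simp only [← mul_assoc] at this
  exact this

theorem nabla_add (w : ℝ) {k : ℕ} {S T : RawField n M k} (hS : IsTensorField S)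
    (hT : IsTensorField T) (x : M) (v : Fin (k + 1) → TangentSpace (𝓡 n) x) :
    g.nabla w (fun y e => S y e + T y e) x v = g.nabla w S x v + g.nabla w T x v := by
  simp only [nabla, g.conn.covD_add hS hT]
  ring

theorem nabla_const_mul (w c : ℝ) {k : ℕ} {T : RawField n M k}
    (hT : IsTensorField T) (x : M) (v : Fin (k + 1) → TangentSpace (𝓡 n) x) :
    g.nabla w (fun y e => c * T y e) x v = c * g.nabla w T x v := by
  simp only [nabla, g.conn.covD_const_mul c hT]
  ring

theorem nabla_swap (w : ℝ) (T : RawField n M 2) (x : M) (c a b : TangentSpace (𝓡 n) x) :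
    g.nabla w (fun y e => T y ![e 1, e 0]) x ![c, a, b] = g.nabla w T x ![c, b, a] := by
  have e : (fun y e => T y ![e 1, e 0] : RawField n M 2) =
      fun y e => T y (fun i => e (Equiv.swap 0 1 i)) := by
    funext y e
    congr 1
    funext i
    fin_cases i <;> rfl
  have e' : (fun i => (![a, b] : Fin 2 → TangentSpace (𝓡 n) x) (Equiv.swap 0 1 i)) = ![b, a] := by
    funext i
    fin_cases i <;> rfl
  rw [e, cons_vecCons, nabla_cons, g.conn.covD_perm, e']
  rfl

theorem nabla_tmul (w : ℝ) {k : ℕ} {S : RawField n M 1} {T : RawField n M k} (hS : IsTensorField S)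
    (hT : IsTensorField T) (x : M) (u v : TangentSpace (𝓡 n) x)
    (e : Fin k → TangentSpace (𝓡 n) x) :
    g.nabla w (fun y e => S y ![e 0] * T y (Fin.tail e) : RawField n M (k + 1)) x
        (Fin.cons u (Fin.cons v e)) =
      g.conn.covD S x ![u, v] * T x e + S x ![v] * g.nabla w T x (Fin.cons u e) := by
  rw [nabla_cons, nabla_cons, g.conn.covD_tmul hS hT]
  simp only [Fin.cons_zero, Fin.tail_cons]
  ring

theorem nabla_mul_scalar (w : ℝ) {k : ℕ} {T : RawField n M k} {τ : RawField n M 0}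
    (hT : IsTensorField T) (hτ : IsTensorField τ) (x : M) (u : TangentSpace (𝓡 n) x)
    (v : Fin k → TangentSpace (𝓡 n) x) :
    g.nabla w (fun y e => T y e * τ y ![]) x (Fin.cons u v) =
      g.conn.covD T x (Fin.cons u v) * τ x ![] + T x v * g.nabla w τ x ![u] := by
  simp only [mul_comm _ (τ _ ![])]
  rw [nabla_cons, cons_vecCons u ![], nabla_cons, g.conn.covD_smul hτ.smoothFn_zero hT,
    ← cons_vecCons u ![], g.conn.covD_zero]
  simp only [Fin.cons_zero, Fin.tail_cons]
  ring

theorem covD_theta_sub_eq (hn : 2 ≤ n) (x : M) (u v : TangentSpace (𝓡 n) x) :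
    g.conn.covD g.theta x ![u, v] - g.conn.covD g.theta x ![v, u] =
      ((n : ℝ) + 1) * (g.Q x ![u, v] - g.Q x ![v, u]) := by
  rw [covD_theta_sub, g.conn.sum_stdCoord_curv, g.conn.schouten_sub_swap hn]
  ring

/-- The Ricci identity for weighted tensors. -/
theorem nabla_nabla_sub (hn : 2 ≤ n) (w : ℝ) {k : ℕ} {T : RawField n M k} (hT : IsTensorField T)
    (x : M) (u v : TangentSpace (𝓡 n) x) (e : Fin k → TangentSpace (𝓡 n) x) :
    g.nabla w (g.nabla w T) x (Fin.cons u (Fin.cons v e))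
      - g.nabla w (g.nabla w T) x (Fin.cons v (Fin.cons u e)) =
      - ∑ i, T x (Function.update e i (g.conn.curv x u v (e i)))
        - w * (g.Q x ![u, v] - g.Q x ![v, u]) * T x e := by
  have h0 : (n : ℝ) + 1 ≠ 0 := by positivity
  -- Apart from `∇∇T` and `∇θ`, all terms are symmetric in `a` and `b`, so the weight contributes
  -- only through `dθ`.
  have key : ∀ a b : TangentSpace (𝓡 n) x,
      g.nabla w (g.nabla w T) x (Fin.cons a (Fin.cons b e)) =
        g.conn.covD (g.conn.covD T) x (Fin.cons a (Fin.cons b e))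
        - w / ((n : ℝ) + 1) * (g.conn.covD g.theta x ![a, b] * T x e
          + g.theta x ![b] * g.conn.covD T x (Fin.cons a e))
        - w / ((n : ℝ) + 1) * g.theta x ![a] * (g.conn.covD T x (Fin.cons b e)
          - w / ((n : ℝ) + 1) * g.theta x ![b] * T x e) := by
    intro a b
    have e1 : g.nabla w T = fun y e => g.conn.covD T y e
        + (-(w / ((n : ℝ) + 1))) * (g.theta y ![e 0] * T y (Fin.tail e)) := by
      funext y e
      simp only [nabla]
      ring
    have hθT := g.isTensorField_theta.tmul hT
    rw [nabla_cons, nabla_cons, e1, g.conn.covD_add (g.conn.isTensorField_covD hT)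
      (hθT.const_mul _), g.conn.covD_const_mul _ hθT,
      g.conn.covD_tmul g.isTensorField_theta hT]
    ring
  have h1 := g.conn.covD_covD_sub hT x u v e
  have h2 := g.covD_theta_sub_eq hn x u v
  have h3 : w / ((n : ℝ) + 1) * (g.conn.covD g.theta x ![u, v] - g.conn.covD g.theta x ![v, u]) =
      w * (g.Q x ![u, v] - g.Q x ![v, u]) := by
    rw [h2]
    field_simp
  rw [key, key, ← h3]
  linear_combination h1

namespace Change

variable {g} {g' : Gauge p} {Y : RawField n M 1} {c : M → ℝ}

theorem ne_zero (h : Change g g' Y c) (x : M) : c x ≠ 0 := fun h0 =>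
  g'.vol.ne_zero x (by rw [h.vol x, h0, zero_smul])

theorem smoothFn (h : Change g g' Y c) : SmoothFn n c := fun x => by
  have hE : ∀ i, SmoothVF (gext (stdBasis (n := n) x i)) := fun i => smoothVF_gext _
  have h1 : SmoothFn n (fun y => g.vol.form y (fun i => gext (stdBasis (n := n) x i) y)) :=
    g.vol.isTensorField.smoothFn hE
  have h1' : SmoothFn n (fun y => g'.vol.form y (fun i => gext (stdBasis (n := n) x i) y)) :=
    g'.vol.isTensorField.smoothFn hE
  have h2 : g.vol.form x (fun i => gext (stdBasis (n := n) x i) x) ≠ 0 := by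
    simpa using g.vol.stdBasis_ne_zero x
  have h3 : ∀ᶠ y in 𝓝 x, g.vol.form y (fun i => gext (stdBasis (n := n) x i) y) ≠ 0 :=
    h1.continuous.continuousAt.eventually_ne h2
  refine ((h1' x).div₀ (h1 x) h2).congr_of_eventuallyEq ?_
  filter_upwards [h3] with y hy
  rw [Pi.div_apply, h.vol y, AlternatingMap.smul_apply, smul_eq_mul, mul_div_assoc, div_self hy,
    mul_one]

/-- `Real.log` ignores the sign, so no case split on the sign of `c` is needed to differentiate `|c|
^ s`. -/
theorem abs_rpow_eq (h : Change g g' Y c) (s : ℝ) :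
    (fun y => |c y| ^ s) = (fun r => Real.exp (s * Real.log r)) ∘ c := by
  funext y
  rw [Function.comp_apply, Real.rpow_def_of_pos (abs_pos.2 (h.ne_zero y)), Real.log_abs, mul_comm]

theorem smoothFn_abs_rpow (h : Change g g' Y c) (s : ℝ) : SmoothFn n (fun y => |c y| ^ s) := by
  rw [h.abs_rpow_eq]
  intro x
  have : ContDiffAt ℝ ∞ (fun r => Real.exp (s * Real.log r)) (c x) :=
    (contDiffAt_const.mul (Real.contDiffAt_log.2 (h.ne_zero x))).exp
  exact this.contMDiffAt.comp x (h.smoothFn x)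

theorem mvfderiv_abs_rpow (h : Change g g' Y c) (s : ℝ) (x : M) (u : TangentSpace (𝓡 n) x) :
    mvfderiv (𝓡 n) (fun y => |c y| ^ s) x u =
      |c x| ^ s * (s * (mvfderiv (𝓡 n) c x u / c x)) := by
  have h0 := h.ne_zero x
  have hd : HasDerivAt (fun r => Real.exp (s * Real.log r))
      (Real.exp (s * Real.log (c x)) * (s * (c x)⁻¹)) (c x) :=
    ((Real.hasDerivAt_log h0).const_mul s).exp
  have hx := congrFun (h.abs_rpow_eq s) x
  simp only [Function.comp_apply] at hx
  rw [h.abs_rpow_eq, hx, mvfderiv_comp_apply x hd.differentiableAt.mdifferentiableAt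
    ((h.smoothFn x).mdifferentiableAt (by simp))]
  have hm : ∀ t : ℝ, mvfderiv 𝓘(ℝ, ℝ) (fun r => Real.exp (s * Real.log r)) (c x) t =
      t * (Real.exp (s * Real.log (c x)) * (s * (c x)⁻¹)) := fun t => by
    simp only [mvfderiv, mfderiv_eq_fderiv]
    rw [hd.hasFDerivAt.fderiv]
    rfl
  refine (hm (mvfderiv (𝓡 n) c x u)).trans ?_
  ring

/-- The rescaling contributes `dc / c`. The connection contributes `-n Y(u)`, one for each slot of
the volume form, and `-Y(u)` as the trace of `Y ⊗ u`. -/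
theorem theta (h : Change g g' Y c) (x : M) (u : TangentSpace (𝓡 n) x) :
    g'.theta x ![u] = g.theta x ![u] + mvfderiv (𝓡 n) c x u / c x - ((n : ℝ) + 1) * Y x ![u] := by
  have h0 := g.vol.stdBasis_ne_zero x
  have h1 := h.ne_zero x
  have e1 : (fun y e => g'.vol.form y e : RawField n M n) = fun y e => c y * g.vol.form y e := by
    funext y e
    rw [h.vol y]
    rfl
  have e2 := g'.covD_vol x u (stdBasis x)
  rw [e1, g'.conn.covD_smul h.smoothFn g.vol.isTensorField,
    g.conn.covD_of_projChange h.conn g.vol.isTensorField, g.covD_vol, h.vol x] at e2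
  have e3 : ∑ i, Y x ![stdBasis x i] * g.vol.form x (Function.update (stdBasis x) i u) =
      Y x ![u] * g.vol.form x (stdBasis x) := by
    have := g.vol.sum_update x (fun i => Y x ![stdBasis x i] • u)
    simp only [AlternatingMap.map_update_smul, smul_eq_mul] at this
    rw [this]
    congr 1
    have := AffineConn.sum_stdCoord_mul (h.oneForm.toLinearMap x) u
    simp only [h.oneForm.toLinearMap_apply] at this
    rw [← this]
    refine Finset.sum_congr rfl fun i _ => ?_
    simp only [← tangentBasis_repr, map_smul, Finsupp.smul_apply, smul_eq_mul]
  rw [e3] at e2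
  simp only [Fin.cons_zero, Fin.tail_cons, AlternatingMap.smul_apply, smul_eq_mul] at e2
  refine mul_right_cancel₀ (mul_ne_zero h1 h0) ?_
  rw [← e2]
  field_simp
  ring

/-- The derivative of `|c| ^ (w / (n + 1))` cancels `dc / c` in the new `theta`; the term `-(n + 1)
Y` there becomes `w Y`. -/
theorem nabla (h : Change g g' Y c) (w : ℝ) {k : ℕ} {T : RawField n M k} (hT : IsTensorField T)
    (x : M) (u : TangentSpace (𝓡 n) x) (v : Fin k → TangentSpace (𝓡 n) x) :
    g'.nabla w (fun y e => |c y| ^ (w / ((n : ℝ) + 1)) * T y e) x (Fin.cons u v) =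
      |c x| ^ (w / ((n : ℝ) + 1)) * (g.nabla w T x (Fin.cons u v) + (w - k) * Y x ![u] * T x v
        - ∑ i, Y x ![v i] * T x (Function.update v i u)) := by
  have h0 : (n : ℝ) + 1 ≠ 0 := by positivity
  rw [nabla_cons, nabla_cons, g'.conn.covD_smul (h.smoothFn_abs_rpow _) hT,
    g.conn.covD_of_projChange h.conn hT, h.theta, h.mvfderiv_abs_rpow]
  simp only [Fin.cons_zero, Fin.tail_cons]
  field_simp
  ring

theorem schouten (hn : 2 ≤ n) (h : Change g g' Y c) (x : M) (v w : TangentSpace (𝓡 n) x) :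
    g'.Q x ![v, w] = g.Q x ![v, w] - g.conn.covD Y x ![v, w] + Y x ![v] * Y x ![w] :=
  g.conn.schouten_of_projChange hn h.oneForm h.conn x v w

end Change

theorem exists_scale (vol vol' : VolumeForm n M) :
    ∃ c : M → ℝ, ∀ x, vol'.form x = c x • vol.form x := by
  refine ⟨fun x => vol'.form x (stdBasis x) / vol.form x (stdBasis x), fun x => ?_⟩
  ext v
  have h0 := vol.stdBasis_ne_zero x
  rw [AlternatingMap.smul_apply, smul_eq_mul, vol'.eq_mul_det, vol.eq_mul_det x v]
  field_simp

theorem exists_change (g g' : Gauge p) : ∃ Y c, Change g g' Y c := by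
  obtain ⟨Y, hY, h⟩ := (p.mem_iff g.conn g.mem g'.conn).1 g'.mem
  obtain ⟨c, hc⟩ := exists_scale g.vol g'.vol
  exact ⟨Y, c, hY, h, hc⟩

end Gauge

/-! ### Transformation laws for derivatives of the tractor slots. -/

theorem vec_one {α : Type*} (e : Fin 1 → α) : e = ![e 0] := by
  funext i
  fin_cases i
  rfl

theorem vec_two {α : Type*} (e : Fin 2 → α) : e = ![e 0, e 1] := by
  funext i
  fin_cases i <;> rfl

theorem vec_three {α : Type*} (e : Fin 3 → α) : e = ![e 0, e 1, e 2] := by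
  funext i
  fin_cases i <;> rfl

theorem IsTensorField.swap {T : RawField n M 2} (hT : IsTensorField T) :
    IsTensorField (fun y e => T y ![e 1, e 0] : RawField n M 2) := by
  have e : (fun y e => T y ![e 1, e 0] : RawField n M 2) =
      fun y e => T y (fun i => e (Equiv.swap 0 1 i)) := by
    funext y e
    congr 1
    funext i
    fin_cases i <;> rfl
  rw [e]
  exact hT.perm _

namespace Gauge.Change

variable {p : ProjectiveStructure n M} {g g' : Gauge p} {Y : RawField n M 1} {c : M → ℝ}

theorem nabla_zero (h : Change g g' Y c) {T T' : RawField n M 0} (hT : IsTensorField T)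
    (hT' : ∀ x, T' x ![] = |c x| ^ (2 / ((n : ℝ) + 1)) * T x ![])
    (x : M) (u : TangentSpace (𝓡 n) x) :
    g'.nabla 2 T' x ![u] =
      |c x| ^ (2 / ((n : ℝ) + 1)) * (g.nabla 2 T x ![u] + 2 * Y x ![u] * T x ![]) := by
  have e : T' = fun y e => |c y| ^ (2 / ((n : ℝ) + 1)) * T y e := by
    funext y e
    rw [eq_vecEmpty e, hT']
  rw [e, cons_vecCons u ![], h.nabla 2 hT]
  simp

theorem nabla_one (h : Change g g' Y c) {T T' : RawField n M 1} (hT : IsTensorField T)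
    (hT' : ∀ x a, T' x ![a] = |c x| ^ (2 / ((n : ℝ) + 1)) * T x ![a])
    (x : M) (u a : TangentSpace (𝓡 n) x) :
    g'.nabla 2 T' x ![u, a] = |c x| ^ (2 / ((n : ℝ) + 1)) *
      (g.nabla 2 T x ![u, a] + Y x ![u] * T x ![a] - Y x ![a] * T x ![u]) := by
  have e : T' = fun y e => |c y| ^ (2 / ((n : ℝ) + 1)) * T y e := by
    funext y e
    rw [vec_one e, hT']
  have e1 : Function.update ![a] 0 u = ![u] := by
    funext i
    fin_cases i
    rfl
  rw [e, cons_vecCons u ![a], h.nabla 2 hT]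
  simp only [Fin.sum_univ_one, e1, Matrix.cons_val_zero]
  push_cast
  ring

theorem nabla_two (h : Change g g' Y c) {T T' : RawField n M 2} (hT : IsTensorField T)
    (hT' : ∀ x a b, T' x ![a, b] = |c x| ^ (2 / ((n : ℝ) + 1)) * T x ![a, b])
    (x : M) (u a b : TangentSpace (𝓡 n) x) :
    g'.nabla 2 T' x ![u, a, b] = |c x| ^ (2 / ((n : ℝ) + 1)) *
      (g.nabla 2 T x ![u, a, b] - Y x ![a] * T x ![u, b] - Y x ![b] * T x ![a, u]) := by
  have e : T' = fun y e => |c y| ^ (2 / ((n : ℝ) + 1)) * T y e := by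
    funext y e
    rw [vec_two e, hT']
  have e1 : Function.update ![a, b] 0 u = ![u, b] := by
    funext i
    fin_cases i <;> rfl
  have e2 : Function.update ![a, b] 1 u = ![a, u] := by
    funext i
    fin_cases i <;> rfl
  rw [e, cons_vecCons u ![a, b], h.nabla 2 hT]
  simp only [Fin.sum_univ_two, e1, e2, Matrix.cons_val_zero, Matrix.cons_val_one]
  push_cast
  ring

/-- The two summands are kept together because `∇Y`, from differentiating `Y ⊗ τ`, cancels only
against the change of `Q`. -/
theorem nabla_mid (hn : 2 ≤ n) (h : Change g g' Y c) {τ τ' : RawField n M 0}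
    {μ μ' : RawField n M 1} (hτ : IsTensorField τ) (hμ : IsTensorField μ)
    (hτ' : ∀ x, τ' x ![] = |c x| ^ (2 / ((n : ℝ) + 1)) * τ x ![])
    (hμ' : ∀ x a, μ' x ![a] =
      |c x| ^ (2 / ((n : ℝ) + 1)) * (μ x ![a] + Y x ![a] * τ x ![]))
    (x : M) (u a : TangentSpace (𝓡 n) x) :
    g'.nabla 2 μ' x ![u, a] + g'.Q x ![u, a] * τ' x ![] = |c x| ^ (2 / ((n : ℝ) + 1)) *
      (g.nabla 2 μ x ![u, a] + g.Q x ![u, a] * τ x ![] + Y x ![a] * g.nabla 2 τ x ![u]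
        + Y x ![u] * μ x ![a] - Y x ![a] * μ x ![u] + Y x ![u] * Y x ![a] * τ x ![]) := by
  have h1 := h.oneForm.tmul hτ
  set P₁ : RawField n M 1 := fun y e => Y y ![e 0] * τ y (Fin.tail e) with hP₁
  have v1 : ∀ x a, P₁ x ![a] = Y x ![a] * τ x ![] := fun x a =>
    congrArg (fun e => Y x ![a] * τ x e) (eq_vecEmpty _)
  have e : ∀ x a, μ' x ![a] = |c x| ^ (2 / ((n : ℝ) + 1)) *
      (fun y e => μ y e + P₁ y e : RawField n M 1) x ![a] := fun x a => by
    simp only [hμ', v1]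
  have t1 : g.nabla 2 P₁ x ![u, a] = g.conn.covD Y x ![u, a] * τ x ![]
      + Y x ![a] * g.nabla 2 τ x ![u] := g.nabla_tmul 2 h.oneForm hτ x u a ![]
  rw [h.nabla_one (hμ.add h1) e, h.schouten hn, hτ', g.nabla_add 2 hμ h1, t1, v1, v1]
  ring

/-- Again the change of `Q` absorbs `∇Y`. The factors beside `Y a`, `Y b` and `Y a * Y b` are
exactly the middle and top slots of the tractor derivative. -/
theorem nabla_bot (hn : 2 ≤ n) (h : Change g g' Y c) {τ : RawField n M 0}
    {μ μ' : RawField n M 1} {ν ν' : RawField n M 2}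
    (hτ : IsTensorField τ) (hμ : IsTensorField μ) (hν : IsTensorField ν)
    (hsymm : ∀ x a b, ν x ![a, b] = ν x ![b, a])
    (hμ' : ∀ x a, μ' x ![a] =
      |c x| ^ (2 / ((n : ℝ) + 1)) * (μ x ![a] + Y x ![a] * τ x ![]))
    (hν' : ∀ x a b, ν' x ![a, b] = |c x| ^ (2 / ((n : ℝ) + 1)) *
      (ν x ![a, b] + Y x ![a] * μ x ![b] + Y x ![b] * μ x ![a]
        + Y x ![a] * Y x ![b] * τ x ![]))
    (x : M) (u a b : TangentSpace (𝓡 n) x) :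
    g'.nabla 2 ν' x ![u, a, b] + (g'.Q x ![u, a] * μ' x ![b] + g'.Q x ![u, b] * μ' x ![a]) =
      |c x| ^ (2 / ((n : ℝ) + 1)) * (g.nabla 2 ν x ![u, a, b]
        + (g.Q x ![u, a] * μ x ![b] + g.Q x ![u, b] * μ x ![a])
        + Y x ![a] * (g.nabla 2 μ x ![u, b] + g.Q x ![u, b] * τ x ![] - ν x ![u, b])
        + Y x ![b] * (g.nabla 2 μ x ![u, a] + g.Q x ![u, a] * τ x ![] - ν x ![u, a])
        + Y x ![a] * Y x ![b] * (g.nabla 2 τ x ![u] - 2 * μ x ![u])) := by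
  have h1 := h.oneForm.tmul hτ
  have h2 := h.oneForm.tmul hμ
  have h3 := h.oneForm.tmul h1
  set P₁ : RawField n M 1 := fun y e => Y y ![e 0] * τ y (Fin.tail e) with hP₁
  set P₂ : RawField n M 2 := fun y e => Y y ![e 0] * μ y (Fin.tail e) with hP₂
  set P₃ : RawField n M 2 := fun y e => Y y ![e 0] * P₁ y (Fin.tail e) with hP₃
  have v1 : ∀ x a, P₁ x ![a] = Y x ![a] * τ x ![] := fun x a =>
     congrArg (fun e => Y x ![a] * τ x e) (eq_vecEmpty _)
  have v2 : ∀ x a b, P₂ x ![a, b] = Y x ![a] * μ x ![b] := fun x a b => rfl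
  have v3 : ∀ x a b, P₃ x ![a, b] = Y x ![a] * P₁ x ![b] := fun x a b => rfl
  have e : ∀ x a b, ν' x ![a, b] = |c x| ^ (2 / ((n : ℝ) + 1)) *
      (fun y e => ((ν y e + P₂ y e) + P₂ y ![e 1, e 0]) + P₃ y e : RawField n M 2) x
        ![a, b] := fun x a b => by
    simp only [hν', v1, v2, v3, Matrix.cons_val_zero, Matrix.cons_val_one]
    ring
  have t1 : ∀ a, g.nabla 2 P₁ x ![u, a] = g.conn.covD Y x ![u, a] * τ x ![]
      + Y x ![a] * g.nabla 2 τ x ![u] := fun a => g.nabla_tmul 2 h.oneForm hτ x u a ![]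
  have t2 : ∀ a b, g.nabla 2 P₂ x ![u, a, b] = g.conn.covD Y x ![u, a] * μ x ![b]
      + Y x ![a] * g.nabla 2 μ x ![u, b] := fun a b => g.nabla_tmul 2 h.oneForm hμ x u a ![b]
  have t3 : g.nabla 2 P₃ x ![u, a, b] = g.conn.covD Y x ![u, a] * P₁ x ![b]
      + Y x ![a] * g.nabla 2 P₁ x ![u, b] := g.nabla_tmul 2 h.oneForm h1 x u a ![b]
  rw [h.nabla_two (((hν.add h2).add h2.swap).add h3) e,
    g.nabla_add 2 ((hν.add h2).add h2.swap) h3, g.nabla_add 2 (hν.add h2) h2.swap,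
    g.nabla_add 2 hν h2, g.nabla_swap, t3, t2, t2, t1, h.schouten hn, h.schouten hn, hμ', hμ']
  simp only [v1, v2, v3, Matrix.cons_val_zero, Matrix.cons_val_one]
  rw [hsymm x a u]
  ring

end Gauge.Change

/-! ### The tractor connection and the splitting operator. -/

theorem IsTensorField.rotate {T : RawField n M 3} (hT : IsTensorField T) :
    IsTensorField (fun y e => T y ![e 2, e 0, e 1] : RawField n M 3) := by
  have e : (fun y e => T y ![e 2, e 0, e 1] : RawField n M 3) =
      fun y e => T y (fun i => e ((finRotate 3).symm i)) := by
    funext y e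
    congr 1
    funext i
    fin_cases i <;> rfl
  rw [e]
  exact hT.perm _

theorem IsTensorField.swap_fst {T : RawField n M 3} (hT : IsTensorField T) :
    IsTensorField (fun y e => T y ![e 1, e 0, e 2] : RawField n M 3) := by
  have e : (fun y e => T y ![e 1, e 0, e 2] : RawField n M 3) =
      fun y e => T y (fun i => e (Equiv.swap 0 1 i)) := by
    funext y e
    congr 1
    funext i
    fin_cases i <;> rfl
  rw [e]
  exact hT.perm _

theorem IsTensorField.mul_scalar {k : ℕ} {T : RawField n M k} {τ : RawField n M 0}
    (hT : IsTensorField T) (hτ : IsTensorField τ) :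
    IsTensorField (fun y e => T y e * τ y ![] : RawField n M k) := by
  simpa only [mul_comm] using hT.smul hτ.smoothFn_zero

theorem isTensorField_mul_add_mul {S : RawField n M 2} {μ : RawField n M 1}
    (hS : IsTensorField S) (hμ : IsTensorField μ) :
    IsTensorField (fun y e => S y ![e 0, e 1] * μ y ![e 2] + S y ![e 0, e 2] * μ y ![e 1] :
      RawField n M 3) := by
  convert (hμ.tmul hS).rotate.add (hμ.tmul hS).swap_fst using 3 with y e
  simp only [mul_comm (μ _ _)]
  rfl

variable {p : ProjectiveStructure n M}

/-- The tractor connection on sections of `𝒯_{(AB)}`. -/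
def tractorDeriv (hn : 2 ≤ n) (s : TractorSection p) : TractorForm p where
  top g := fun x v => g.nabla 2 (s.top g) x v - 2 * s.mid g x v
  mid g := fun x v => g.nabla 2 (s.mid g) x v + g.Q x v * s.top g x ![] - s.bot g x v
  bot g := fun x v => g.nabla 2 (s.bot g) x v
    + (g.Q x ![v 0, v 1] * s.mid g x ![v 2] + g.Q x ![v 0, v 2] * s.mid g x ![v 1])
  top_tensor g := (g.isTensorField_nabla 2 (s.top_tensor g)).sub ((s.mid_tensor g).const_mul 2)
  mid_tensor g := ((g.isTensorField_nabla 2 (s.mid_tensor g)).add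
    (g.conn.isTensorField_schouten.mul_scalar (s.top_tensor g))).sub (s.bot_tensor g)
  bot_tensor g := (g.isTensorField_nabla 2 (s.bot_tensor g)).add
    (isTensorField_mul_add_mul g.conn.isTensorField_schouten (s.mid_tensor g))
  bot_symm g x c a b := by
    have e : s.bot g = fun y e => s.bot g y ![e 1, e 0] := by
      funext y e
      rw [← s.bot_symm, ← vec_two]
    have h := g.nabla_swap 2 (s.bot g) x c a b
    rw [← e] at h
    rw [h]
    simp only [Matrix.cons_val_zero, Matrix.cons_val_one, Matrix.cons_val]
    ring
  top_change g g' Y f h x c := by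
    rw [h.nabla_zero (s.top_tensor g) (s.top_change g g' Y f h), s.mid_change g g' Y f h]
    ring
  mid_change g g' Y f h x c a := by
    rw [h.nabla_mid hn (s.top_tensor g) (s.mid_tensor g) (s.top_change g g' Y f h)
      (s.mid_change g g' Y f h), s.bot_change g g' Y f h]
    ring
  bot_change g g' Y f h x c a b := h.nabla_bot hn (s.top_tensor g) (s.mid_tensor g)
    (s.bot_tensor g) (s.bot_symm g) (s.mid_change g g' Y f h) (s.bot_change g g' Y f h) x c a b

theorem isTractorDeriv_tractorDeriv (hn : 2 ≤ n) (s : TractorSection p) :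
    IsTractorDeriv s (tractorDeriv hn s) :=
  ⟨fun _ _ _ => rfl, fun _ _ _ _ => rfl, fun _ _ _ _ _ => rfl⟩

/-- On densities only the weight term of the Ricci identity survives. It makes `½ ∇∇σ + Q σ`
symmetric, as a bottom slot must be. -/
theorem Gauge.nabla_nabla_swap (hn : 2 ≤ n) (g : Gauge p) {τ : RawField n M 0}
    (hτ : IsTensorField τ) (x : M) (a b : TangentSpace (𝓡 n) x) :
    g.nabla 2 (g.nabla 2 τ) x ![a, b] - g.nabla 2 (g.nabla 2 τ) x ![b, a] =
      - 2 * (g.Q x ![a, b] - g.Q x ![b, a]) * τ x ![] := by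
  have h := g.nabla_nabla_sub hn 2 hτ x a b ![]
  simp only [Finset.univ_eq_empty, Finset.sum_empty] at h
  refine h.trans ?_
  ring

/-- The splitting operator `σ ↦ (σ, ½ ∇_a σ, (½ ∇_a ∇_b + Q_{ab}) σ)`. -/
def splitting (hn : 2 ≤ n) (p : ProjectiveStructure n M) (σ : TensorDensity n M 0 2) :
    TractorSection p where
  top g := σ.comp g.vol
  mid g := fun x v => (1 / 2) * g.nabla 2 (σ.comp g.vol) x v
  bot g := fun x v => (1 / 2) * g.nabla 2 (g.nabla 2 (σ.comp g.vol)) x v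
    + g.Q x v * σ.comp g.vol x ![]
  top_tensor g := σ.isTensor g.vol
  mid_tensor g := (g.isTensorField_nabla 2 (σ.isTensor g.vol)).const_mul _
  bot_tensor g := ((g.isTensorField_nabla 2 (g.isTensorField_nabla 2
    (σ.isTensor g.vol))).const_mul _).add
      (g.conn.isTensorField_schouten.mul_scalar (σ.isTensor g.vol))
  bot_symm g x a b := by
    linear_combination (1 / 2) * g.nabla_nabla_swap hn (σ.isTensor g.vol) x a b
  top_change g g' Y c h x := σ.scale g.vol g'.vol x (c x) (h.vol x) ![]
  mid_change g g' Y c h x a := by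
    rw [h.nabla_zero (σ.isTensor g.vol)
      fun x => σ.scale g.vol g'.vol x (c x) (h.vol x) ![]]
    ring
  bot_change g g' Y c h x a b := by
    have h0 : ∀ x, σ.comp g'.vol x ![] = |c x| ^ (2 / ((n : ℝ) + 1)) * σ.comp g.vol x ![] :=
      fun x => σ.scale g.vol g'.vol x (c x) (h.vol x) ![]
    -- The bottom slot is `∇v + Q τ` with `v = ½ ∇σ`, so its law is an instance of `nabla_mid`;
    -- substituting `∇τ = 2 v` there gives the tractor law.
    have h1 := h.nabla_mid hn (σ.isTensor g.vol)
      ((g.isTensorField_nabla 2 (σ.isTensor g.vol)).const_mul (1 / 2)) h0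
      (μ' := fun x v => (1 / 2) * g'.nabla 2 (σ.comp g'.vol) x v)
      (fun x a => by rw [h.nabla_zero (σ.isTensor g.vol) h0]; ring) x a b
    rw [g.nabla_const_mul 2 _ (g.isTensorField_nabla 2 (σ.isTensor g.vol)),
      g'.nabla_const_mul 2 _ (g'.isTensorField_nabla 2 (σ.isTensor g'.vol))] at h1
    rw [h1]
    ring

theorem tractorDeriv_splitting_top (hn : 2 ≤ n) (σ : TensorDensity n M 0 2) (g : Gauge p) :
    (tractorDeriv hn (splitting hn p σ)).top g = fun _ _ => 0 := by
  funext x v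
  simp only [tractorDeriv, splitting]
  ring

theorem tractorDeriv_splitting_mid (hn : 2 ≤ n) (σ : TensorDensity n M 0 2) (g : Gauge p) :
    (tractorDeriv hn (splitting hn p σ)).mid g = fun _ _ => 0 := by
  funext x v
  simp only [tractorDeriv, splitting]
  rw [g.nabla_const_mul 2 _ (g.isTensorField_nabla 2 (σ.isTensor g.vol))]
  ring

theorem tractorDeriv_splitting_bot (hn : 2 ≤ n) (σ : TensorDensity n M 0 2) (g : Gauge p) :
    (tractorDeriv hn (splitting hn p σ)).bot g = DtildeIn g (σ.comp g.vol) := by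
  funext x v
  have h1 := g.isTensorField_nabla 2 (σ.isTensor g.vol)
  have h2 := g.isTensorField_nabla 2 h1
  simp only [tractorDeriv, splitting, DtildeIn]
  rw [g.nabla_add 2 (h2.const_mul _)
    (g.conn.isTensorField_schouten.mul_scalar (σ.isTensor g.vol)), g.nabla_const_mul 2 _ h2,
    ← vec_three v]
  ring

/-- Coclosedness controls only the symmetric part of the middle slot, which still determines the
bottom slot because that slot is symmetric by definition of a tractor section. -/
theorem eq_splitting_iff (hn : 2 ≤ n) (σ : TensorDensity n M 0 2) (s : TractorSection p) :
    s = splitting hn p σ ↔ ProjectsTo s σ ∧ IsCoclosed (tractorDeriv hn s) := by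
  constructor
  · rintro rfl
    refine ⟨fun g => rfl, fun g x a b => ?_⟩
    rw [tractorDeriv_splitting_top, tractorDeriv_splitting_mid]
    simp
  · rintro ⟨htop, hco⟩
    have hmid : ∀ g, s.mid g = (splitting hn p σ).mid g := fun g => by
      funext x v
      have h := (hco g x (v 0) (v 0)).1
      simp only [tractorDeriv, htop g, ← vec_one v] at h
      change _ = (1 / 2) * g.nabla 2 (σ.comp g.vol) x v
      linear_combination (-1 / 2) * h
    have hbot : ∀ g, s.bot g = (splitting hn p σ).bot g := fun g => by
      funext x v
      have h := (hco g x (v 0) (v 1)).2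
      have h' : (tractorDeriv hn (splitting hn p σ)).mid g x ![v 0, v 1]
          + (tractorDeriv hn (splitting hn p σ)).mid g x ![v 1, v 0] = 0 := by
        rw [tractorDeriv_splitting_mid]
        simp
      simp only [tractorDeriv, htop g, hmid] at h h'
      have e : (splitting hn p σ).top g = σ.comp g.vol := rfl
      rw [e] at h'
      rw [vec_two v]
      linear_combination (1 / 2) * (h' - h) + (1 / 2) * s.bot_symm g x (v 0) (v 1)
        - (1 / 2) * (splitting hn p σ).bot_symm g x (v 0) (v 1)
    ext1
    · exact funext htop
    · exact funext hmid
    · exact funext hbot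

/-! ### Tractor forms concentrated in the bottom slot. -/

namespace TractorForm

variable (φ : TractorForm p)

/-- Any two gauges are related by some `Y` and `f`. The `Y` terms multiply vanishing slots, and `f
x` is fixed by the two volume forms at `x`. -/
theorem bot_eq_of_change (htop : ∀ g, φ.top g = fun _ _ => 0) (hmid : ∀ g, φ.mid g = fun _ _ => 0)
    {g g' : Gauge p} {x : M} {c : ℝ} (hc : g'.vol.form x = c • g.vol.form x)
    (v : Fin 3 → TangentSpace (𝓡 n) x) :
    φ.bot g' x v = |c| ^ (2 / ((n : ℝ) + 1)) * φ.bot g x v := by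
  obtain ⟨Y, f, h⟩ := Gauge.exists_change g g'
  have hf : f x = c := by
    have := (h.vol x).symm.trans hc
    have h0 := DFunLike.congr_fun this (stdBasis x)
    exact mul_right_cancel₀ (g.vol.stdBasis_ne_zero x) h0
  rw [vec_three v, φ.bot_change g g' Y f h, htop, hmid, hf]
  simp

/-- The weighted tensor in the bottom slot of a tractor form whose other slots vanish. -/
def botDensity (htop : ∀ g, φ.top g = fun _ _ => 0) (hmid : ∀ g, φ.mid g = fun _ _ => 0) :
    OneTwoDensity n M 2 where
  -- The chosen connection is immaterial by `bot_eq_of_change`, with scale factor `1`.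
  comp vol := φ.bot ⟨p.nonempty.some, p.nonempty.some_mem, vol⟩
  isTensor _ := φ.bot_tensor _
  scale _ _ _ _ hc v := φ.bot_eq_of_change htop hmid hc v
  symm _ := φ.bot_symm _

theorem botDensity_comp (htop : ∀ g, φ.top g = fun _ _ => 0)
    (hmid : ∀ g, φ.mid g = fun _ _ => 0) (g : Gauge p) :
    (φ.botDensity htop hmid).comp g.vol = φ.bot g := by
  funext x v
  have h := φ.bot_eq_of_change htop hmid (g := g)
    (g' := ⟨p.nonempty.some, p.nonempty.some_mem, g.vol⟩) (one_smul ℝ (g.vol.form x)).symm v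
  exact h.trans (by simp)

theorem eq_insertBot (htop : ∀ g, φ.top g = fun _ _ => 0) (hmid : ∀ g, φ.mid g = fun _ _ => 0) :
    φ = insertBot p (φ.botDensity htop hmid) := by
  ext1
  · exact funext htop
  · exact funext hmid
  · exact funext fun g => (φ.botDensity_comp htop hmid g).symm

end TractorForm

/-! ### The mixed symmetry part and the Weyl-Cotton formula. -/

theorem symm3_apply (T : RawField n M 3) (x : M) (v : Fin 3 → TangentSpace (𝓡 n) x) :
    symm3 T x v = (1 / 6) * (T x ![v 0, v 1, v 2] + T x ![v 0, v 2, v 1] + T x ![v 1, v 0, v 2]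
      + T x ![v 1, v 2, v 0] + T x ![v 2, v 0, v 1] + T x ![v 2, v 1, v 0]) := by
  have key : ∀ ρ : Equiv.Perm (Fin 3), (fun i => v (ρ i)) = ![v (ρ 0), v (ρ 1), v (ρ 2)] :=
    fun ρ => vec_three _
  have hu : (Finset.univ : Finset (Equiv.Perm (Fin 3))) =
      {1, Equiv.swap 1 2, Equiv.swap 0 1, finRotate 3, (finRotate 3).symm, Equiv.swap 0 2} := by
    decide
  simp only [symm3, key, hu]
  rw [Finset.sum_insert (by decide), Finset.sum_insert (by decide), Finset.sum_insert (by decide),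
    Finset.sum_insert (by decide), Finset.sum_insert (by decide), Finset.sum_singleton]
  simp only [← add_assoc]
  rfl

theorem IsTensorField.symm3 {T : RawField n M 3} (hT : IsTensorField T) :
    IsTensorField (symm3 T) :=
  (IsTensorField.sum fun ρ _ => hT.perm ρ).const_mul _

theorem symm3_sub_symm3 (c : ℝ) (T : RawField n M 3) (x : M)
    (v : Fin 3 → TangentSpace (𝓡 n) x) :
    symm3 (fun y e => c * (T y e - symm3 T y e)) x v = 0 := by
  simp only [symm3_apply, Matrix.cons_val_zero, Matrix.cons_val_one, Matrix.cons_val]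
  ring

/-- `c` times the mixed symmetry part of `α`. -/
def OneTwoDensity.mixedPart {w : ℝ} (c : ℝ) (α : OneTwoDensity n M w) : OneTwoDensity n M w where
  comp vol := fun x v => c * (α.comp vol x v - symm3 (α.comp vol) x v)
  isTensor vol := ((α.isTensor vol).sub (α.isTensor vol).symm3).const_mul c
  scale vol vol' x r hr v := by
    simp only [symm3_apply, α.scale vol vol' x r hr]
    ring
  symm vol x a b d := by
    simp only [symm3_apply, Matrix.cons_val_zero, Matrix.cons_val_one, Matrix.cons_val]
    rw [α.symm vol x a b d]
    ring

theorem Gauge.nabla_weyl (g : Gauge p) {τ : RawField n M 0} (hτ : IsTensorField τ) (x : M)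
    (u v w : TangentSpace (𝓡 n) x) :
    g.nabla 2 τ x ![g.conn.weyl x u v w] = g.nabla 2 τ x ![g.conn.curv x u v w]
      - (g.Q x ![v, w] * g.nabla 2 τ x ![u] - g.Q x ![u, w] * g.nabla 2 τ x ![v])
      + (g.Q x ![u, v] - g.Q x ![v, u]) * g.nabla 2 τ x ![w] := by
  have h := g.isTensorField_nabla 2 hτ
  change h.toLinearMap x _ = h.toLinearMap x _ - (_ * h.toLinearMap x _ - _ * h.toLinearMap x _)
    + _ * h.toLinearMap x _
  rw [AffineConn.weyl, map_add, map_sub, map_sub, map_smul, map_smul, map_smul]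
  rfl

/-- Commuting the outer two derivatives on `∇τ` gives curvature and `-2` times the skew part `Q_{ca}
- Q_{ac}`, both halved. Together with the remaining terms `Q ∇τ` these form `-½ W ∇τ`, and the
derivatives of `Q` form the Cotton tensor. -/
theorem DtildeIn_sub_swap (hn : 2 ≤ n) (g : Gauge p) {τ : RawField n M 0} (hτ : IsTensorField τ)
    (x : M) (c a b : TangentSpace (𝓡 n) x) :
    DtildeIn g τ x ![c, a, b] - DtildeIn g τ x ![a, c, b] =
      -(1 / 2) * g.nabla 2 τ x ![g.conn.weyl x c a b] + g.conn.cotton x ![c, a, b] * τ x ![] := by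
  have e1 : Function.update ![b] 0 (g.conn.curv x c a b) = ![g.conn.curv x c a b] := by
    funext i
    fin_cases i
    rfl
  have h1 : g.nabla 2 (g.nabla 2 (g.nabla 2 τ)) x ![c, a, b]
      - g.nabla 2 (g.nabla 2 (g.nabla 2 τ)) x ![a, c, b] =
      - g.nabla 2 τ x ![g.conn.curv x c a b]
        - 2 * (g.Q x ![c, a] - g.Q x ![a, c]) * g.nabla 2 τ x ![b] := by
    refine (g.nabla_nabla_sub hn 2 (g.isTensorField_nabla 2 hτ) x c a ![b]).trans ?_
    rw [← e1]
    congr 2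
    exact Fin.sum_univ_one _
  have h2 : ∀ u v : TangentSpace (𝓡 n) x, g.nabla 2 (fun y e => g.Q y e * τ y ![]) x ![u, v, b] =
      g.conn.covD g.Q x ![u, v, b] * τ x ![] + g.Q x ![v, b] * g.nabla 2 τ x ![u] :=
    fun u v => g.nabla_mul_scalar 2 g.conn.isTensorField_schouten hτ x u ![v, b]
  simp only [DtildeIn, AffineConn.cotton, Matrix.cons_val_zero, Matrix.cons_val_one,
    Matrix.cons_val, h2, g.nabla_weyl hτ]
  linear_combination (1 / 2) * h1

/-- For `T` symmetric in its last two indices,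
$T_{cab}-T_{(cab)}=\frac13(T_{cab}-T_{acb})+\frac13(T_{cba}-T_{bca})$, and each difference is given
by `DtildeIn_sub_swap`. -/
theorem DtildeIn_sub_symm3 (hn : 2 ≤ n) (g : Gauge p) {τ : RawField n M 0} (hτ : IsTensorField τ)
    (hsymm : ∀ (x : M) (c a b : TangentSpace (𝓡 n) x),
      DtildeIn g τ x ![c, a, b] = DtildeIn g τ x ![c, b, a])
    (x : M) (v : Fin 3 → TangentSpace (𝓡 n) x) :
    DtildeIn g τ x v - symm3 (DtildeIn g τ) x v = -(1 / 3) * DmixedIn g τ x v := by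
  have h1 := DtildeIn_sub_swap hn g hτ x (v 0) (v 1) (v 2)
  have h2 := DtildeIn_sub_swap hn g hτ x (v 0) (v 2) (v 1)
  have e := congrArg (DtildeIn g τ x) (vec_three v)
  rw [e, symm3_apply]
  simp only [DmixedIn]
  linear_combination (1 / 3) * h1 + (1 / 3) * h2 + (1 / 2) * hsymm x (v 0) (v 1) (v 2)
    + (1 / 6) * hsymm x (v 1) (v 0) (v 2) + (1 / 6) * hsymm x (v 2) (v 0) (v 1)

end

end ProjectiveGeometry

end

theorem mainTheorem5 (n : ℕ) (hn : 2 ≤ n) (M : Type*) [TopologicalSpace M] [T2Space M]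
    [SecondCountableTopology M] [ChartedSpace (EuclideanSpace ℝ (Fin n)) M]
    [IsManifold (𝓡 n) ∞ M]
    (_orientable : Nonempty (ProjectiveGeometry.VolumeForm n M))
    (p : ProjectiveGeometry.ProjectiveStructure n M) :
    ∃ (dT : ProjectiveGeometry.TractorSection p → ProjectiveGeometry.TractorForm p)
      (L₀ : ProjectiveGeometry.TensorDensity n M 0 2 → ProjectiveGeometry.TractorSection p)
      (Dt Dm : ProjectiveGeometry.TensorDensity n M 0 2 →
        ProjectiveGeometry.OneTwoDensity n M 2),
      -- `dT` is the tractor connection, well defined on sections of the tractor bundle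
      (∀ s, ProjectiveGeometry.IsTractorDeriv s (dT s)) ∧
      -- `L₀` is the splitting operator
      (∀ σ s, s = L₀ σ ↔
        ProjectiveGeometry.ProjectsTo s σ ∧ ProjectiveGeometry.IsCoclosed (dT s)) ∧
      -- `L₀ σ` is the triple `(σ, ½ ∇_a σ, (½ ∇_a ∇_b + Q_{ab}) σ)` in every gauge
      (∀ σ (g : ProjectiveGeometry.Gauge p) (x : M) (a b : TangentSpace (𝓡 n) x),
        (L₀ σ).top g x ![] = σ.comp g.vol x ![] ∧
        (L₀ σ).mid g x ![a] = (1 / 2) * g.nabla 2 (σ.comp g.vol) x ![a] ∧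
        (L₀ σ).bot g x ![a, b] =
          (1 / 2) * g.nabla 2 (g.nabla 2 (σ.comp g.vol)) x ![a, b]
            + g.Q x ![a, b] * σ.comp g.vol x ![]) ∧
      -- `Dt` is given by its formula in every gauge of the projective structure
      (∀ σ (g : ProjectiveGeometry.Gauge p),
        (Dt σ).comp g.vol = ProjectiveGeometry.DtildeIn g (σ.comp g.vol)) ∧
      -- the diagram commutes
      (∀ σ, dT (L₀ σ) = ProjectiveGeometry.insertBot p (Dt σ)) ∧
      -- the Weyl-Cotton operator is projectively invariant: `Dm`, which does not depend on the
      -- connection, is given by its formula in every gauge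
      (∀ σ (g : ProjectiveGeometry.Gauge p),
        (Dm σ).comp g.vol = ProjectiveGeometry.DmixedIn g (σ.comp g.vol)) ∧
      -- it takes values in the mixed symmetry part and is, up to a constant factor, the mixed
      -- symmetry part of `Dt`
      (∀ σ vol (x : M) v, ProjectiveGeometry.symm3 ((Dm σ).comp vol) x v = 0) ∧
      (∀ σ vol (x : M) v,
        (Dt σ).comp vol x v - ProjectiveGeometry.symm3 ((Dt σ).comp vol) x v
          = -(1 / 3) * (Dm σ).comp vol x v) := by
  open ProjectiveGeometry in
  refine ⟨tractorDeriv hn, splitting hn p,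
    -- `Dt` is the bottom slot of `dT (L₀ σ)`, so invariance is built in and its formula is then
    -- computed in each gauge.
    fun σ => (tractorDeriv hn (splitting hn p σ)).botDensity
      (tractorDeriv_splitting_top hn σ) (tractorDeriv_splitting_mid hn σ),
    -- The factor `-3` inverts the constant `-1/3` relating the mixed part of `Dt` to the
    -- Weyl-Cotton operator.
    fun σ => ((tractorDeriv hn (splitting hn p σ)).botDensity
      (tractorDeriv_splitting_top hn σ) (tractorDeriv_splitting_mid hn σ)).mixedPart (-3),
    isTractorDeriv_tractorDeriv hn, eq_splitting_iff hn, fun _ _ _ _ _ => ⟨rfl, rfl, rfl⟩,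
    fun σ g => ?_, fun σ => TractorForm.eq_insertBot _ _ _, fun σ g => ?_,
    fun σ vol x v => symm3_sub_symm3 (-3) _ x v, fun σ vol x v => ?_⟩
  · rw [TractorForm.botDensity_comp, tractorDeriv_splitting_bot]
  · have e := TractorForm.botDensity_comp _ (tractorDeriv_splitting_top hn σ)
      (tractorDeriv_splitting_mid hn σ) g
    rw [tractorDeriv_splitting_bot] at e
    funext x v
    -- The symmetry of `DtildeIn` in its last two indices is inherited from the bottom slot of a
    -- tractor form.
    have h := DtildeIn_sub_symm3 hn g (σ.isTensor g.vol) (fun x c a b => by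
      rw [← e]
      exact OneTwoDensity.symm _ g.vol x c a b) x v
    simp only [OneTwoDensity.mixedPart, e, h]
    ring
  · simp only [OneTwoDensity.mixedPart]
    ring
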